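/- **Theorem.** Consider $n$ agents with independent non-negative valuations $v_i\sim F_i$, where each $F_i$ is a regular distribution (it has a density $f_i$ for which the virtual value $\phi_i(v)=v-\frac{1-F_i(v)}{f_i(v)}$ is non-decreasing on $\{F_i<1\}$, with $\phi_i=-\infty$ where $f_i=0$), and discount factors $w_i\in[0,1]$. If the set $S$ of agents buys the good, agent $i$ derives from it the fraction $x_i(S)$ of her value, where $x_i(S)=1$ if $i\in S$, $x_i(S)=w_i$ if $i\notin S\neq\emptyset$, and $x_i(\emptyset)=0$ (status-based externalities). In a simultaneous sale with prices $\mathbf p\in[0,\infty]^n$, a Nash equilibrium is a vector of thresholds $\mathbf T\in[0,\infty]^n$ with $$T_i=\frac{p_i}{1-\mathrm E_{S}[x_i(S)]}\qquad(i=1,\dots,n),$$ where the random set $S\not\ni i$ contains each $j\ne i$ independently with probability $1-F_j(T_j)$, a quotient with denominator $0$ is read as $\infty$, and $F_j(\infty)=1$. Its revenue is $\mathcal R(\mathbf p,\mathbf T)=\sum_i p_i(1-F_i(T_i))$. Let $\mathcal R^*=\sup\mathcal R(\mathbf p^*,\mathbf T^*)$ over all price vectors $\mathbf p^*$ and all equilibria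 $\mathbf T^*$ induced by $\mathbf p^*$. There is an algorithm that, given $n$, the $w_i$, and oracle access to the quantile functions $F_i^{-1}(q)$, $0<q<1$, computes finite non-negative prices $\mathbf p$ in time polynomial in $n$ (exact real arithmetic operations, comparisons and oracle queries each cost one step), such that in every equilibrium $\mathbf T$ induced by $\mathbf p$ $$\mathcal R^*\le 6.83\cdot\mathcal R(\mathbf p,\mathbf T).$$ -/

import Mathlib

open MeasureTheory ProbabilityTheory Set
open scoped ENNReal

/-! ### Value distributions -/

namespace SocialGoods

/-- The virtual value `φ(v) = v - (1 - F(v)) / f(v)` of a distribution function `F` with density `f`.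
It is only used at points where `F v < 1`, so where the density vanishes it is `-∞`. -/
noncomputable def virtualValue (F f : ℝ → ℝ) (v : ℝ) : EReal :=
  open Classical in
  if f v = 0 then ⊥ else ((v - (1 - F v) / f v : ℝ) : EReal)

/-- A distribution is regular if it has a density whose virtual value function is non-decreasing
(on the set where `F v < 1`; where `F v = 1` there is no constraint). -/
def IsRegular (μ : Measure ℝ) : Prop :=
  ∃ f : ℝ → ℝ, Measurable f ∧ (∀ v, 0 ≤ f v) ∧
    μ = volume.withDensity (fun v => ENNReal.ofReal (f v)) ∧
    MonotoneOn (virtualValue (cdf μ) f) {v | cdf μ v < 1}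

/-- The distribution function on the extended half-line, with `F(∞) = 1`. -/
noncomputable def extCdf (μ : Measure ℝ) (t : ℝ≥0∞) : ℝ :=
  open Classical in
  if t = ⊤ then 1 else cdf μ t.toReal

/-- The quantile `F⁻¹(q)`, the least `v` with `q ≤ F(v)`, for `0 < q < 1`; it is `0` for other `q`. -/
noncomputable def quantile (μ : Measure ℝ) (q : ℝ) : ℝ :=
  open Classical in
  if 0 < q ∧ q < 1 then sInf {v : ℝ | q ≤ cdf μ v} else 0

/-! ### Simultaneous sales of social goods -/

variable {n : ℕ}

/-- Status-based externalities: the fraction of her value that agent `i` derives when the set `S` of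
agents purchases the good, where `w i` is the discount factor of agent `i`. -/
noncomputable def statusExternality (w : Fin n → ℝ) (i : Fin n) (S : Finset (Fin n)) : ℝ :=
  open Classical in
  if i ∈ S then 1 else if S.Nonempty then w i else 0

/-- `E_{S ∼ μ_T^{-i}}[x_i(S)]`: every agent `j ≠ i` belongs to the random set `S` independently with
probability `1 - F_j(T_j)`, and agent `i` does not belong to `S`. -/
noncomputable def expectedExternality (μ : Fin n → Measure ℝ)
    (x : Fin n → Finset (Fin n) → ℝ) (T : Fin n → ℝ≥0∞) (i : Fin n) : ℝ :=
  ∑ S ∈ (Finset.univ.erase i).powerset,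
    (∏ j ∈ S, (1 - extCdf (μ j) (T j))) *
      (∏ j ∈ Finset.univ.erase i \ S, extCdf (μ j) (T j)) * x i S

/-- The thresholds `T` form a Nash equilibrium of the simultaneous sale with prices `p`:
`T_i = p_i / (1 - E[x_i(S)])` for every `i`, where a quotient with denominator `0` is `∞`. -/
def IsEquilibrium (μ : Fin n → Measure ℝ) (x : Fin n → Finset (Fin n) → ℝ)
    (p T : Fin n → ℝ≥0∞) : Prop :=
  open Classical in
  ∀ i, T i = if 1 - expectedExternality μ x T i = 0 then ⊤
    else p i / ENNReal.ofReal (1 - expectedExternality μ x T i)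

/-- The expected revenue `∑ i, p_i (1 - F_i(T_i))`. -/
noncomputable def revenue (μ : Fin n → Measure ℝ) (p T : Fin n → ℝ≥0∞) : ℝ≥0∞ :=
  ∑ i, p i * ENNReal.ofReal (1 - extCdf (μ i) (T i))

/-- The benchmark: the supremum of the revenue over all price vectors and all equilibria that they
induce. A price `∞` means that the agent is not offered the good. -/
noncomputable def optimalRevenue (μ : Fin n → Measure ℝ) (x : Fin n → Finset (Fin n) → ℝ) : ℝ≥0∞ :=
  ⨆ (p : Fin n → ℝ≥0∞) (T : Fin n → ℝ≥0∞) (_ : IsEquilibrium μ x p T), revenue μ p T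

end SocialGoods

/-! ### Algorithms: programs over exact real arithmetic with an oracle, and their step counts -/

namespace RealRAM

/-- A memory state: natural-number variables (counters and array indices), and arrays of reals. -/
structure State where
  idx : ℕ → ℕ
  arr : ℕ → ℕ → ℝ

/-- Index expressions. There is no multiplication. -/
inductive IdxExpr where
  | const (c : ℕ)
  | var (x : ℕ)
  | add (e₁ e₂ : IdxExpr)
  | sub (e₁ e₂ : IdxExpr)

/-- Real expressions; `cell a e` is entry `e` of array `a`, and `query e r` asks the oracle with
index `e` at the real number `r`. -/
inductive RealExpr where
  | const (c : ℚ)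
  | cast (e : IdxExpr)
  | cell (a : ℕ) (e : IdxExpr)
  | add (r₁ r₂ : RealExpr)
  | sub (r₁ r₂ : RealExpr)
  | mul (r₁ r₂ : RealExpr)
  | div (r₁ r₂ : RealExpr)
  | query (e : IdxExpr) (r : RealExpr)

/-- Tests. -/
inductive Test where
  | leIdx (e₁ e₂ : IdxExpr)
  | leReal (r₁ r₂ : RealExpr)
  | not (b : Test)

/-- Programs. -/
inductive Program where
  | skip
  | setIdx (x : ℕ) (e : IdxExpr)
  | setReal (a : ℕ) (e : IdxExpr) (r : RealExpr)
  | seq (c₁ c₂ : Program)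
  | branch (b : Test) (c₁ c₂ : Program)
  | loop (b : Test) (c : Program)

/-- The value of an index expression. -/
def IdxExpr.eval (s : State) : IdxExpr → ℕ
  | const c => c
  | var x => s.idx x
  | add e₁ e₂ => e₁.eval s + e₂.eval s
  | sub e₁ e₂ => e₁.eval s - e₂.eval s

/-- The number of steps in the evaluation of an index expression: one for each node. -/
def IdxExpr.cost : IdxExpr → ℕ
  | const _ => 1
  | var _ => 1
  | add e₁ e₂ => 1 + e₁.cost + e₂.cost
  | sub e₁ e₂ => 1 + e₁.cost + e₂.cost

/-- The value of a real expression, given the oracle `O`. -/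
noncomputable def RealExpr.eval (O : ℕ → ℝ → ℝ) (s : State) : RealExpr → ℝ
  | const c => (c : ℝ)
  | cast e => (e.eval s : ℝ)
  | cell a e => s.arr a (e.eval s)
  | add r₁ r₂ => r₁.eval O s + r₂.eval O s
  | sub r₁ r₂ => r₁.eval O s - r₂.eval O s
  | mul r₁ r₂ => r₁.eval O s * r₂.eval O s
  | div r₁ r₂ => r₁.eval O s / r₂.eval O s
  | query e r => O (e.eval s) (r.eval O s)

/-- The number of steps in the evaluation of a real expression: one for each node. -/
def RealExpr.cost : RealExpr → ℕ
  | const _ => 1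
  | cast e => 1 + e.cost
  | cell _ e => 1 + e.cost
  | add r₁ r₂ => 1 + r₁.cost + r₂.cost
  | sub r₁ r₂ => 1 + r₁.cost + r₂.cost
  | mul r₁ r₂ => 1 + r₁.cost + r₂.cost
  | div r₁ r₂ => 1 + r₁.cost + r₂.cost
  | query e r => 1 + e.cost + r.cost

/-- The truth of a test. -/
def Test.holds (O : ℕ → ℝ → ℝ) (s : State) : Test → Prop
  | leIdx e₁ e₂ => e₁.eval s ≤ e₂.eval s
  | leReal r₁ r₂ => r₁.eval O s ≤ r₂.eval O s
  | not b => ¬ b.holds O s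

/-- The number of steps in the evaluation of a test. -/
def Test.cost : Test → ℕ
  | leIdx e₁ e₂ => 1 + e₁.cost + e₂.cost
  | leReal r₁ r₂ => 1 + r₁.cost + r₂.cost
  | not b => 1 + b.cost

/-- Assignment to a natural-number variable. -/
def State.setIdx (s : State) (x k : ℕ) : State :=
  { s with idx := Function.update s.idx x k }

/-- Assignment to an entry of a real array. -/
noncomputable def State.setReal (s : State) (a k : ℕ) (r : ℝ) : State :=
  { s with arr := Function.update s.arr a (Function.update (s.arr a) k r) }

/-- `Exec O c s t s'`: with the oracle `O`, the program `c` started in the state `s` halts after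
exactly `t` steps in the state `s'`. -/
inductive Exec (O : ℕ → ℝ → ℝ) : Program → State → ℕ → State → Prop
  | skip (s : State) : Exec O .skip s 1 s
  | setIdx (x : ℕ) (e : IdxExpr) (s : State) :
      Exec O (.setIdx x e) s (1 + e.cost) (s.setIdx x (e.eval s))
  | setReal (a : ℕ) (e : IdxExpr) (r : RealExpr) (s : State) :
      Exec O (.setReal a e r) s (1 + e.cost + r.cost) (s.setReal a (e.eval s) (r.eval O s))
  | seq {c₁ c₂ : Program} {s s' s'' : State} {t t' : ℕ} :
      Exec O c₁ s t s' → Exec O c₂ s' t' s'' → Exec O (.seq c₁ c₂) s (t + t') s''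
  | branch_true {b : Test} {c₁ c₂ : Program} {s s' : State} {t : ℕ} :
      b.holds O s → Exec O c₁ s t s' → Exec O (.branch b c₁ c₂) s (b.cost + t) s'
  | branch_false {b : Test} {c₁ c₂ : Program} {s s' : State} {t : ℕ} :
      ¬ b.holds O s → Exec O c₂ s t s' → Exec O (.branch b c₁ c₂) s (b.cost + t) s'
  | loop_false {b : Test} {c : Program} {s : State} :
      ¬ b.holds O s → Exec O (.loop b c) s b.cost s
  | loop_true {b : Test} {c : Program} {s s' s'' : State} {t t' : ℕ} :
      b.holds O s → Exec O c s t s' → Exec O (.loop b c) s' t' s'' →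
        Exec O (.loop b c) s (b.cost + t + t') s''

end RealRAM

namespace SocialGoods

variable {n : ℕ}

/-- The initial state on an instance with `n` agents: variable `0` holds `n`, and array `0` holds the
discount factors; everything else is `0`. -/
noncomputable def initialState (w : Fin n → ℝ) : RealRAM.State where
  idx x := if x = 0 then n else 0
  arr a k := if h : k < n then (if a = 0 then w ⟨k, h⟩ else 0) else 0

/-- Oracle access to the value distributions: a query `(i, q)` is answered by the quantile
`F_i⁻¹(q)`. -/
noncomputable def quantileOracle (μ : Fin n → Measure ℝ) (k : ℕ) (q : ℝ) : ℝ :=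
  if h : k < n then quantile (μ ⟨k, h⟩) q else 0

/-- The price vector found in array `1` of the final state. -/
def outputPrices (n : ℕ) (s : RealRAM.State) (i : Fin n) : ℝ := s.arr 1 i

end SocialGoods

/-! Write `r i t = t (1 - F i t)`, and let `Q i` be the probability that nobody but `i` buys. An
equilibrium with finite thresholds has `p i = T i (1 - w i + w i Q i)`, so its revenue is the sum of
all `(1 - w i) r i (T i)` and all `w i Q i r i (T i)`. The first sum is at most `A`, the sum of the
separate maxima of `(1 - w i) r i`. In the second, the agents with `w i T i ≥ c` contribute at most
`B c`, the sum of the maxima of `w i r i t` over `w i t ≥ c`; the others contribute at most `c`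
times the probability that exactly one agent buys. Hence the optimum is at most `A + B c + c` for
every `c ≥ 0` (`IsEquilibrium.revenue_le`).

Conversely, if `v i` maximises `r i`, then the prices `(1 - w i) v i` earn `A` in every equilibrium,
because no threshold that matters exceeds `v i` (`IsEquilibrium.revenue_ge_discounted`). If `(1 - a)
c ≤ B c`, prices `a w i v i ≥ a c` with the `v i` that attain `B c` earn `a (1 - a) c`
(`IsEquilibrium.revenue_ge_floor`): either nobody buys with probability at least `a`, the thresholds
stay below `v i`, and the revenue is at least `a B c`; or somebody buys with probability at least `1
- a`, and every buyer pays at least `a c`.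

Let `c` be the largest floor with `(1 - a) c ≤ B c`. Beyond `c` the value of `B` is at most `(1 - a)
c`, so the optimum is at most `A + (2 - a) c`, and the better of the two price vectors is within the
factor `1 + (2 - a) / (a (1 - a))`. Its minimum, at `a = 2 - √2`, is `4 + 2√2 < 6.8285`; the slack
up to `6.83` pays for a rational `a` and for discretisation.

The maxima are taken over a grid of selling probabilities. By regularity, prices beyond the end of
the grid gain almost nothing (`IsRegular.revenue_le`, `exists_grid_price`). On the grid `B` is a
step function that jumps only at grid values, so the best floor is found among quadratically many
candidates (`IsBestFloor`). -/

namespace SocialGoods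

/-! ### Distribution functions with a density. -/

section Density

variable {μ : Measure ℝ} [IsProbabilityMeasure μ] {f : ℝ → ℝ}

lemma integrable_density (hfm : Measurable f) (hf0 : ∀ v, 0 ≤ f v)
    (hμ : μ = volume.withDensity (fun v => ENNReal.ofReal (f v))) : Integrable f := by
  refine ⟨hfm.aestronglyMeasurable, ?_⟩
  rw [hasFiniteIntegral_iff_ofReal (ae_of_all _ hf0)]
  have h : μ univ = ∫⁻ v, ENNReal.ofReal (f v) := by
    rw [hμ, withDensity_apply _ MeasurableSet.univ, Measure.restrict_univ]
  rw [← h]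
  exact measure_lt_top _ _

lemma cdf_eq_integral_Iic (hfm : Measurable f) (hf0 : ∀ v, 0 ≤ f v)
    (hμ : μ = volume.withDensity (fun v => ENNReal.ofReal (f v))) (x : ℝ) :
    cdf μ x = ∫ v in Iic x, f v := by
  rw [integral_eq_lintegral_of_nonneg_ae (ae_of_all _ hf0) hfm.aestronglyMeasurable,
    ← withDensity_apply _ measurableSet_Iic, ← hμ, cdf_eq_real, measureReal_def]

lemma cdf_eq_add_integral (hfm : Measurable f) (hf0 : ∀ v, 0 ≤ f v)
    (hμ : μ = volume.withDensity (fun v => ENNReal.ofReal (f v))) (a x : ℝ) :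
    cdf μ x = cdf μ a + ∫ v in a..x, f v := by
  have hi := integrable_density hfm hf0 hμ
  rw [cdf_eq_integral_Iic hfm hf0 hμ, cdf_eq_integral_Iic hfm hf0 hμ,
    ← intervalIntegral.integral_Iic_sub_Iic hi.integrableOn hi.integrableOn]
  ring

lemma cdf_zero_eq_zero
    (hμ : μ = volume.withDensity (fun v => ENNReal.ofReal (f v))) (h0 : μ (Iio 0) = 0) :
    cdf μ 0 = 0 := by
  have : μ {0} = 0 := by
    rw [hμ]
    exact withDensity_absolutelyContinuous _ _ (by simp)
  rw [cdf_eq_real, measureReal_def, ← Iio_union_right, measure_union_null h0 this]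
  rfl

lemma continuous_cdf_of_density (hfm : Measurable f) (hf0 : ∀ v, 0 ≤ f v)
    (hμ : μ = volume.withDensity (fun v => ENNReal.ofReal (f v))) : Continuous (cdf μ) := by
  have hi := integrable_density hfm hf0 hμ
  have : (cdf μ : ℝ → ℝ) = fun x => cdf μ 0 + ∫ v in (0 : ℝ)..x, f v :=
    funext fun x => cdf_eq_add_integral hfm hf0 hμ 0 x
  rw [this]
  exact continuous_const.add (intervalIntegral.continuous_primitive (fun _ _ => hi.intervalIntegrable) _)

/-- The increment of `(1 - F(v)) (v - s)` is the integral of its almost everywhere derivative. -/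
lemma survival_mul_sub (hfm : Measurable f) (hf0 : ∀ v, 0 ≤ f v)
    (hμ : μ = volume.withDensity (fun v => ENNReal.ofReal (f v))) (s a b : ℝ) :
    ∫ v in a..b, ((1 - cdf μ v) - f v * (v - s)) =
      (1 - cdf μ b) * (b - s) - (1 - cdf μ a) * (a - s) := by
  have hi := integrable_density hfm hf0 hμ
  -- The density is only integrable, so `F` has derivative `f` only almost everywhere; absolute
  -- continuity is what makes the fundamental theorem available.
  have hF : AbsolutelyContinuousOnInterval (fun v => ∫ t in a..v, f t) a b :=
    hi.intervalIntegrable.absolutelyContinuousOnInterval_intervalIntegral (by simp)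
  have hS : AbsolutelyContinuousOnInterval (fun v => (1 - cdf μ a) - ∫ t in a..v, f t) a b :=
    (contDiffOn_const (n := 1)).absolutelyContinuousOnInterval.fun_sub hF
  have hv : AbsolutelyContinuousOnInterval (fun v : ℝ => v - s) a b :=
    (contDiff_id.sub contDiff_const).contDiffOn (n := 1) |>.absolutelyContinuousOnInterval
  have hg := (hS.fun_mul hv).integral_deriv_eq_sub
  have hFe : ∀ v, 1 - cdf μ v = (1 - cdf μ a) - ∫ t in a..v, f t := fun v => by
    rw [cdf_eq_add_integral hfm hf0 hμ a v]; ring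
  have he := hg
  rw [← hFe b, ← hFe a] at he
  rw [← he]
  refine intervalIntegral.integral_congr_ae ?_
  filter_upwards [(hi.intervalIntegrable (a := a) (b := b)).ae_hasDerivAt_integral] with x hx hxm
  have h1 := hx (uIoc_subset_uIcc hxm) a (by simp)
  have h2 := ((h1.const_sub (1 - cdf μ a)).mul ((hasDerivAt_id x).sub_const s)).deriv
  simp only [hFe x]
  refine Eq.trans ?_ h2.symm
  simp only [id]
  ring

end Density

/-! ### Regular distributions: revenue curve and quantile grid. -/

section Regular

variable {μ : Measure ℝ} [IsProbabilityMeasure μ]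

lemma IsRegular.continuous_cdf (h : IsRegular μ) : Continuous (cdf μ) := by
  obtain ⟨f, hfm, hf0, hμ, -⟩ := h
  exact continuous_cdf_of_density hfm hf0 hμ

lemma IsRegular.cdf_zero (h : IsRegular μ) (h0 : μ (Iio 0) = 0) : cdf μ 0 = 0 := by
  obtain ⟨f, hfm, hf0, hμ, -⟩ := h
  exact cdf_zero_eq_zero hμ h0

/-- The revenue of a regular distribution at a price above `v₀` compared to the one at `v₀`. -/
lemma IsRegular.revenue_le (h : IsRegular μ) (h0 : μ (Iio 0) = 0) {v₀ T : ℝ} (hv : 0 ≤ v₀)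
    (hT : v₀ ≤ T) (hF0 : 0 < cdf μ v₀) (hF1 : cdf μ v₀ < 1) :
    T * (1 - cdf μ T) * cdf μ v₀ ≤ v₀ * (1 - cdf μ v₀) := by
  have hz := h.cdf_zero h0
  obtain ⟨f, hfm, hf0, hμ, hmono⟩ := h
  have hm := monotone_cdf μ
  rcases eq_or_lt_of_le (cdf_le_one μ T) with hT1 | hT1
  · rw [hT1, sub_self, mul_zero, zero_mul]
    exact mul_nonneg hv (by linarith)
  -- A zero density gives virtual value `⊥` at `v₀`, hence by monotonicity everywhere below; then
  -- `f` vanishes on `[0, v₀]` and `F v₀ = 0`.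
  have hfv : f v₀ ≠ 0 := by
    intro hfv
    have hzero : ∀ u ∈ uIcc 0 v₀, f u = (fun _ => (0 : ℝ)) u := by
      intro u hu
      rw [uIcc_of_le hv] at hu
      by_contra hne
      have := hmono (a := u) (b := v₀) ((hm hu.2).trans_lt hF1) hF1 hu.2
      simp only [virtualValue, hfv, if_true, if_neg hne, le_bot_iff] at this
      exact EReal.coe_ne_bot _ this
    have := cdf_eq_add_integral hfm hf0 hμ 0 v₀
    rw [intervalIntegral.integral_congr hzero, hz] at this
    simp at this
    linarith
  -- With `s` the virtual value at `v₀`, regularity says that `(1 - F v) (v - s)` increases up to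
  -- `v₀` and decreases from there to `T`. This is the tangent line to the concave revenue curve; it
  -- is compared with the curve at `0` and at `T`.
  set s := v₀ - (1 - cdf μ v₀) / f v₀ with hs
  have hvs : virtualValue (cdf μ) f v₀ = (s : EReal) := by simp [virtualValue, hfv, hs]
  have below : ∀ v, v ≤ v₀ → f v * (v - s) ≤ 1 - cdf μ v := by
    intro v hvv
    by_cases hfz : f v = 0
    · rw [hfz, zero_mul]; linarith [cdf_le_one μ v]
    · have := hmono (a := v) (b := v₀) ((hm hvv).trans_lt hF1) hF1 hvv
      rw [hvs] at this
      simp only [virtualValue, if_neg hfz, EReal.coe_le_coe_iff] at this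
      have hpos : 0 < f v := lt_of_le_of_ne (hf0 v) (Ne.symm hfz)
      have h2 : v - s ≤ (1 - cdf μ v) / f v := by linarith
      rw [le_div_iff₀ hpos] at h2
      linarith
  have above : ∀ v, v₀ ≤ v → v ≤ T → 1 - cdf μ v ≤ f v * (v - s) := by
    intro v hvv hvT
    have := hmono (a := v₀) (b := v) hF1 ((hm hvT).trans_lt hT1) hvv
    rw [hvs] at this
    by_cases hfz : f v = 0
    · simp only [virtualValue, if_pos hfz, le_bot_iff] at this
      exact absurd this (EReal.coe_ne_bot _)
    · simp only [virtualValue, if_neg hfz, EReal.coe_le_coe_iff] at this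
      have hpos : 0 < f v := lt_of_le_of_ne (hf0 v) (Ne.symm hfz)
      have h2 : (1 - cdf μ v) / f v ≤ v - s := by linarith
      rw [div_le_iff₀ hpos] at h2
      linarith
  have e1 : 0 ≤ (1 - cdf μ v₀) * (v₀ - s) - (1 - cdf μ 0) * (0 - s) := by
    rw [← survival_mul_sub hfm hf0 hμ s 0 v₀]
    exact intervalIntegral.integral_nonneg hv fun v hv' => sub_nonneg.2 (below v hv'.2)
  have e2 : (1 - cdf μ T) * (T - s) - (1 - cdf μ v₀) * (v₀ - s) ≤ 0 := by
    rw [← survival_mul_sub hfm hf0 hμ s v₀ T]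
    have : 0 ≤ ∫ v in v₀..T, -((1 - cdf μ v) - f v * (v - s)) :=
      intervalIntegral.integral_nonneg hT fun v hv' => by
        have := above v hv'.1 hv'.2
        linarith
    rw [intervalIntegral.integral_neg] at this
    linarith
  rw [hz] at e1
  have hmT := hm hT
  set F0 := cdf μ v₀
  set FT := cdf μ T
  have h1 : 0 ≤ v₀ * (1 - F0) + s * F0 := by linarith
  have h2 : T * (1 - FT) ≤ v₀ * (1 - F0) - s * (FT - F0) := by linarith
  -- For `s ≥ 0` the revenue does not grow beyond `v₀`. For `s ≤ 0` it grows by at most `-s (1 -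
  -- F0)`, while `e1` gives `-s F0 ≤ v₀ (1 - F0)`.
  rcases le_total 0 s with hs0 | hs0
  · have : T * (1 - FT) ≤ v₀ * (1 - F0) := by nlinarith
    have h3 : 0 ≤ v₀ * (1 - F0) := mul_nonneg hv (by linarith)
    nlinarith
  · have h3 : T * (1 - FT) ≤ v₀ * (1 - F0) - s * (1 - F0) := by nlinarith
    nlinarith

/-- A density makes the distribution function continuous, so the infimum is attained and there is no
jump over `q`. Posting this quantile therefore sells with probability exactly `1 - q`. -/
lemma quantile_spec (h : IsRegular μ) (h0 : μ (Iio 0) = 0) {q : ℝ} (hq0 : 0 < q) (hq1 : q < 1) :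
    0 ≤ quantile μ q ∧ cdf μ (quantile μ q) = q := by
  have hz := h.cdf_zero h0
  have hc := h.continuous_cdf
  have hmem : ∀ v ∈ {v : ℝ | q ≤ cdf μ v}, 0 ≤ v := by
    intro v hv
    by_contra hneg
    have := monotone_cdf μ (not_le.1 hneg).le
    have hv' : q ≤ cdf μ v := hv
    linarith
  have hne : {v : ℝ | q ≤ cdf μ v}.Nonempty :=
    ((tendsto_cdf_atTop μ).eventually (eventually_ge_nhds hq1)).exists
  have hbdd : BddBelow {v : ℝ | q ≤ cdf μ v} := ⟨0, hmem⟩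
  have hcl : IsClosed {v : ℝ | q ≤ cdf μ v} := isClosed_le continuous_const hc
  have hin := hcl.csInf_mem hne hbdd
  have heq : quantile μ q = sInf {v : ℝ | q ≤ cdf μ v} := if_pos ⟨hq0, hq1⟩
  rw [heq]
  refine ⟨hmem _ hin, le_antisymm ?_ hin⟩
  set x := sInf {v : ℝ | q ≤ cdf μ v}
  obtain ⟨y, hy, hyq⟩ : q ∈ cdf μ '' Icc 0 x :=
    intermediate_value_Icc (hmem _ hin) hc.continuousOn ⟨by rw [hz]; exact hq0.le, hin⟩
  have : x ≤ y := csInf_le hbdd (show q ≤ cdf μ y from hyq.ge)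
  rw [← hyq]
  exact monotone_cdf μ this

lemma quantile_nonneg (h : IsRegular μ) (h0 : μ (Iio 0) = 0) (q : ℝ) : 0 ≤ quantile μ q := by
  by_cases hq : 0 < q ∧ q < 1
  · exact (quantile_spec h h0 hq.1 hq.2).1
  · simp [quantile, hq]

/-- The survival probabilities that make up the grid of resolution `m`. -/
noncomputable def gridProb (m : ℝ) (k : ℕ) : ℝ := m / (m + (k + 1))

/-- Any price is matched, up to the factor `1 + 1 / m`, by a grid price that is at least as high or
by the highest one. -/
lemma exists_grid_price (h : IsRegular μ) (h0 : μ (Iio 0) = 0) {m : ℝ} (hm : 1 ≤ m) {K : ℕ}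
    (hK : 0 < K) (hKm : m * m ≤ K) {T : ℝ} (hT : 0 ≤ T) :
    ∃ k < K, T * (1 - cdf μ T) ≤
        (1 + 1 / m) * (quantile μ (1 - gridProb m k) * gridProb m k) ∧
      (T ≤ quantile μ (1 - gridProb m k) ∨ k + 1 = K) := by
  have hy0 : ∀ k, 0 < gridProb m k := fun k => by unfold gridProb; positivity
  have hy1 : ∀ k, gridProb m k < 1 := fun k => by
    unfold gridProb
    rw [div_lt_one (by positivity)]
    have : (0 : ℝ) ≤ k := Nat.cast_nonneg k
    linarith
  have hq := fun k => quantile_spec h h0 (q := 1 - gridProb m k) (by linarith [hy1 k])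
    (by linarith [hy0 k])
  have hcT := cdf_le_one μ T
  -- The first grid probability below the selling probability of `T` belongs to a price above `T`,
  -- and its predecessor, larger by a factor of at most `1 + 1 / m`, is not below.
  by_cases hex : ∃ k, k < K ∧ gridProb m k < 1 - cdf μ T
  · classical
    obtain ⟨hk, hky⟩ := Nat.find_spec hex
    set k := Nat.find hex with hkdef
    have hTv : T ≤ quantile μ (1 - gridProb m k) := by
      by_contra hlt
      have := monotone_cdf μ (not_le.1 hlt).le
      rw [(hq k).2] at this
      linarith
    refine ⟨k, hk, ?_, Or.inl hTv⟩
    have hyk : 1 - cdf μ T ≤ (1 + 1 / m) * gridProb m k := by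
      have hgrid : (1 + 1 / m) * gridProb m k = (m + 1) / (m + (k + 1)) := by
        unfold gridProb; field_simp
      rw [hgrid]
      rcases Nat.eq_zero_or_pos k with hk0 | hkpos
      · rw [hk0]
        simp only [Nat.cast_zero, zero_add]
        rw [div_self (by positivity)]
        linarith [cdf_nonneg μ T]
      · have hmin := Nat.find_min hex (m := k - 1) (by omega)
        have hle : 1 - cdf μ T ≤ gridProb m (k - 1) := by
          by_contra hlt
          exact hmin ⟨by omega, not_le.1 hlt⟩
        refine hle.trans ?_
        unfold gridProb
        rw [Nat.cast_sub hkpos]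
        push_cast
        have : (1 : ℝ) ≤ k := by exact_mod_cast hkpos
        rw [div_le_div_iff₀ (by linarith) (by linarith)]
        nlinarith
    calc T * (1 - cdf μ T) ≤ quantile μ (1 - gridProb m k) * ((1 + 1 / m) * gridProb m k) :=
          mul_le_mul hTv hyk (by linarith) (hq k).1
      _ = _ := by ring
  · push Not at hex
    refine ⟨K - 1, by omega, ?_, Or.inr (by omega)⟩
    set k := K - 1 with hkdef
    have hle := hex k (by omega)
    have hv := hq k
    set v := quantile μ (1 - gridProb m k)
    have hyk : m * (1 / (1 + m)) ≤ 1 - gridProb m k := by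
      have hcast : ((k : ℝ) + 1) = K := by
        rw [hkdef, Nat.cast_sub (by omega)]; simp
      have : gridProb m k ≤ 1 / (1 + m) := by
        unfold gridProb
        rw [hcast, div_le_div_iff₀ (by positivity) (by positivity)]
        nlinarith
      have h2 : m * (1 / (1 + m)) = 1 - 1 / (1 + m) := by field_simp; ring
      linarith
    have hmpos : 0 < m * (1 / (1 + m)) := by positivity
    -- Here `T` sells no more often than the last grid price `v`. As `K ≥ m²`, that price has `F v ≥
    -- m / (1 + m)`, so for `T ≥ v` regularity loses only the factor `1 + 1 / m`.
    have hkey : T * (1 - cdf μ T) * (m * (1 / (1 + m))) ≤ v * gridProb m k := by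
      rcases le_total v T with hvT | hvT
      · have := h.revenue_le h0 hv.1 hvT (by rw [hv.2]; linarith [hy1 k])
          (by rw [hv.2]; linarith [hy0 k])
        rw [hv.2] at this
        have h3 : 0 ≤ T * (1 - cdf μ T) := mul_nonneg hT (by linarith)
        have h4 := mul_le_mul_of_nonneg_left hyk h3
        linarith
      · have h3 : T * (1 - cdf μ T) ≤ v * gridProb m k :=
          mul_le_mul hvT hle (by linarith) hv.1
        have h4 : 0 ≤ T * (1 - cdf μ T) := mul_nonneg hT (by linarith)
        have h5 : m * (1 / (1 + m)) ≤ 1 := by linarith [hy0 k]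
        nlinarith
    rw [← le_div_iff₀ hmpos] at hkey
    refine hkey.trans (le_of_eq ?_)
    field_simp
    ring

end Regular

end SocialGoods

namespace SocialGoods

/-! ### Products of probabilities of independent events. -/

section Products

variable {ι : Type*}

/-- The union bound for independent events of probabilities `1 - q i`. -/
lemma one_sub_prod_le_sum (s : Finset ι) (q : ι → ℝ) (h0 : ∀ i, 0 ≤ q i) (h1 : ∀ i, q i ≤ 1) :
    1 - ∏ i ∈ s, q i ≤ ∑ i ∈ s, (1 - q i) := by
  classical
  induction s using Finset.induction_on with
  | empty => simp
  | insert a s ha ih =>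
    rw [Finset.prod_insert ha, Finset.sum_insert ha]
    have hp : ∏ i ∈ s, q i ≤ 1 := Finset.prod_le_one (fun i _ => h0 i) fun i _ => h1 i
    nlinarith [h0 a, h1 a]

/-- The probability that exactly one of several independent events happens is at most `1`. -/
lemma sum_one_sub_mul_prod_erase_le [DecidableEq ι] (s : Finset ι) (q : ι → ℝ)
    (h0 : ∀ i, 0 ≤ q i) (h1 : ∀ i, q i ≤ 1) :
    ∑ i ∈ s, (1 - q i) * ∏ j ∈ s.erase i, q j ≤ 1 - ∏ i ∈ s, q i := by
  induction s using Finset.induction_on with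
  | empty => simp
  | insert a s ha ih =>
    rw [Finset.prod_insert ha, Finset.sum_insert ha, Finset.erase_insert ha]
    have hs : ∑ i ∈ s, (1 - q i) * ∏ j ∈ (insert a s).erase i, q j =
        q a * ∑ i ∈ s, (1 - q i) * ∏ j ∈ s.erase i, q j := by
      rw [Finset.mul_sum]
      refine Finset.sum_congr rfl fun i hi => ?_
      have hne : a ≠ i := fun h => ha (h ▸ hi)
      rw [Finset.erase_insert_of_ne hne, Finset.prod_insert (by simp [ha])]
      ring
    rw [hs]
    have hp : ∏ i ∈ s, q i ≤ 1 := Finset.prod_le_one (fun i _ => h0 i) fun i _ => h1 i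
    have := mul_le_mul_of_nonneg_left ih (h0 a)
    nlinarith [h0 a, h1 a]

end Products

/-! ### Revenue bounds valid in every equilibrium. -/

section Equilibrium

variable {n : ℕ} {μ : Fin n → Measure ℝ} {w : Fin n → ℝ} {p T : Fin n → ℝ≥0∞}

lemma extCdf_nonneg (ν : Measure ℝ) (t : ℝ≥0∞) : 0 ≤ extCdf ν t := by
  unfold extCdf
  split_ifs
  exacts [zero_le_one, cdf_nonneg _ _]

lemma extCdf_le_one (ν : Measure ℝ) (t : ℝ≥0∞) : extCdf ν t ≤ 1 := by
  unfold extCdf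
  split_ifs
  exacts [le_rfl, cdf_le_one _ _]

/-- The probability that no agent other than `i` buys. -/
noncomputable def othersAbstain (μ : Fin n → Measure ℝ) (T : Fin n → ℝ≥0∞) (i : Fin n) : ℝ :=
  ∏ j ∈ Finset.univ.erase i, extCdf (μ j) (T j)

lemma othersAbstain_nonneg (μ : Fin n → Measure ℝ) (T : Fin n → ℝ≥0∞) (i : Fin n) :
    0 ≤ othersAbstain μ T i :=
  Finset.prod_nonneg fun _ _ => extCdf_nonneg _ _

lemma prod_extCdf_le_othersAbstain (μ : Fin n → Measure ℝ) (T : Fin n → ℝ≥0∞) (i : Fin n) :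
    ∏ j, extCdf (μ j) (T j) ≤ othersAbstain μ T i := by
  rw [← Finset.mul_prod_erase _ _ (Finset.mem_univ i)]
  exact mul_le_of_le_one_left (othersAbstain_nonneg μ T i) (extCdf_le_one _ _)

/-- An agent who abstains gets `w i` unless the random set is empty, which has probability
`othersAbstain μ T i`. The probabilities of all sets sum to `1` by expanding `∏ ((1 - q j) + q j)`.
-/
lemma one_sub_expectedExternality (μ : Fin n → Measure ℝ) (w : Fin n → ℝ) (T : Fin n → ℝ≥0∞)
    (i : Fin n) :
    1 - expectedExternality μ (statusExternality w) T i = 1 - w i + w i * othersAbstain μ T i := by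
  have hone := Finset.prod_add (fun j => 1 - extCdf (μ j) (T j)) (fun j => extCdf (μ j) (T j))
    (Finset.univ.erase i)
  simp only [sub_add_cancel, Finset.prod_const_one] at hone
  have hx : ∀ S ∈ (Finset.univ.erase i).powerset,
      (∏ j ∈ S, (1 - extCdf (μ j) (T j))) * (∏ j ∈ Finset.univ.erase i \ S, extCdf (μ j) (T j)) *
        statusExternality w i S =
      (∏ j ∈ S, (1 - extCdf (μ j) (T j))) * (∏ j ∈ Finset.univ.erase i \ S, extCdf (μ j) (T j)) *
        w i - if S = ∅ then w i * othersAbstain μ T i else 0 := by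
    intro S hS
    have hi : i ∉ S := fun h => by simpa using Finset.mem_powerset.1 hS h
    rcases S.eq_empty_or_nonempty with rfl | hne
    · simp [statusExternality, othersAbstain, mul_comm]
    · simp [statusExternality, hi, hne, hne.ne_empty]
  unfold expectedExternality
  rw [Finset.sum_congr rfl hx, Finset.sum_sub_distrib, ← Finset.sum_mul, ← hone,
    Finset.sum_ite_eq' _ ∅]
  simp
  ring

/-- The payment is `T i` times `1 - w i + w i Q`, where `Q = othersAbstain μ T i`. The part with `1
- w i` is charged to `A`; the part with `w i Q` is charged to `B` if `w i T i ≥ c`, and otherwise to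
`c` times the probability that `i` is the only buyer. An infinite threshold contributes nothing. -/
lemma IsEquilibrium.term_le (h : IsEquilibrium μ (statusExternality w) p T) {i : Fin n}
    (hw : w i ∈ Icc (0 : ℝ) 1) {A B c : ℝ}
    (hA : ∀ t, 0 ≤ t → (1 - w i) * (t * (1 - cdf (μ i) t)) ≤ A)
    (hB0 : 0 ≤ B) (hB : ∀ t, 0 ≤ t → c ≤ w i * t → w i * (t * (1 - cdf (μ i) t)) ≤ B)
    (hc : 0 ≤ c) :
    p i * ENNReal.ofReal (1 - extCdf (μ i) (T i)) ≤
      ENNReal.ofReal (A + B + c * ((1 - extCdf (μ i) (T i)) * othersAbstain μ T i)) := by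
  have hi := h i
  rw [one_sub_expectedExternality] at hi
  have hQ0 := othersAbstain_nonneg μ T i
  have hQ1 : othersAbstain μ T i ≤ 1 :=
    Finset.prod_le_one (fun _ _ => extCdf_nonneg _ _) fun _ _ => extCdf_le_one _ _
  set Q := othersAbstain μ T i
  set d := 1 - w i + w i * Q with hd
  by_cases hT : T i = ⊤
  · simp [extCdf, hT]
  have hd0 : d ≠ 0 := fun hd0 => hT (by rw [hi, if_pos hd0])
  rw [if_neg hd0] at hi
  have hdpos : 0 < d := lt_of_le_of_ne
    (add_nonneg (by linarith [hw.2]) (mul_nonneg hw.1 hQ0)) (Ne.symm hd0)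
  have hp : p i = T i * ENNReal.ofReal d := by
    rw [hi, ENNReal.div_mul_cancel (by simpa using hdpos) ENNReal.ofReal_ne_top]
  have hq : extCdf (μ i) (T i) = cdf (μ i) (T i).toReal := if_neg hT
  have ht0 : 0 ≤ (T i).toReal := ENNReal.toReal_nonneg
  rw [hp, hq]
  nth_rewrite 1 [← ENNReal.ofReal_toReal hT]
  set t := (T i).toReal
  have hF := cdf_le_one (μ i) t
  have hF0 := cdf_nonneg (μ i) t
  rw [← ENNReal.ofReal_mul ht0, ← ENNReal.ofReal_mul (mul_nonneg ht0 hdpos.le)]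
  refine ENNReal.ofReal_le_ofReal ?_
  have hAt := hA t ht0
  have hBt : w i * Q * (t * (1 - cdf (μ i) t)) ≤ B + c * ((1 - cdf (μ i) t) * Q) := by
    have hnn : 0 ≤ (1 - cdf (μ i) t) * Q := mul_nonneg (by linarith) hQ0
    rcases le_total c (w i * t) with hct | hct
    · have h1 := hB t ht0 hct
      have h2 : 0 ≤ w i * (t * (1 - cdf (μ i) t)) :=
        mul_nonneg hw.1 (mul_nonneg ht0 (by linarith))
      have h3 := mul_nonneg hc hnn
      nlinarith
    · have := mul_le_mul_of_nonneg_right hct hnn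
      nlinarith
  calc t * d * (1 - cdf (μ i) t)
      = (1 - w i) * (t * (1 - cdf (μ i) t)) + w i * Q * (t * (1 - cdf (μ i) t)) := by rw [hd]; ring
    _ ≤ _ := by linarith

/-- An upper bound on the revenue of every equilibrium. -/
lemma IsEquilibrium.revenue_le (h : IsEquilibrium μ (statusExternality w) p T)
    (hw : ∀ i, w i ∈ Icc (0 : ℝ) 1) {A B : Fin n → ℝ} {c : ℝ}
    (hA : ∀ i t, 0 ≤ t → (1 - w i) * (t * (1 - cdf (μ i) t)) ≤ A i)
    (hB0 : ∀ i, 0 ≤ B i)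
    (hB : ∀ i t, 0 ≤ t → c ≤ w i * t → w i * (t * (1 - cdf (μ i) t)) ≤ B i)
    (hc : 0 ≤ c) :
    revenue μ p T ≤ ENNReal.ofReal (∑ i, A i + ∑ i, B i + c) := by
  have hA0 : ∀ i, 0 ≤ A i := fun i => by simpa using hA i 0 le_rfl
  have hterm : ∀ i, 0 ≤ (1 - extCdf (μ i) (T i)) * othersAbstain μ T i := fun i =>
    mul_nonneg (sub_nonneg.2 (extCdf_le_one _ _)) (othersAbstain_nonneg _ _ _)
  calc revenue μ p T
      ≤ ∑ i, ENNReal.ofReal (A i + B i + c * ((1 - extCdf (μ i) (T i)) * othersAbstain μ T i)) :=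
        Finset.sum_le_sum fun i _ => h.term_le (hw i) (hA i) (hB0 i) (hB i) hc
    _ = ENNReal.ofReal
        (∑ i, (A i + B i + c * ((1 - extCdf (μ i) (T i)) * othersAbstain μ T i))) :=
        (ENNReal.ofReal_sum_of_nonneg fun i _ =>
          add_nonneg (add_nonneg (hA0 i) (hB0 i)) (mul_nonneg hc (hterm i))).symm
    _ ≤ _ := by
        refine ENNReal.ofReal_le_ofReal ?_
        rw [Finset.sum_add_distrib, Finset.sum_add_distrib, ← Finset.mul_sum]
        -- The events of being the only buyer are disjoint, so `c` is charged at most once in total.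
        have h1 := sum_one_sub_mul_prod_erase_le Finset.univ (fun j => extCdf (μ j) (T j))
          (fun _ => extCdf_nonneg _ _) fun _ => extCdf_le_one _ _
        have h2 : 0 ≤ ∏ j, extCdf (μ j) (T j) := Finset.prod_nonneg fun _ _ => extCdf_nonneg _ _
        have h3 : ∑ i, (1 - extCdf (μ i) (T i)) * othersAbstain μ T i ≤ 1 :=
          h1.trans (by linarith)
        linarith [mul_le_of_le_one_right hc h3]

/-- A price that is low enough for the equilibrium threshold to be at most `v`. -/
lemma IsEquilibrium.term_ge (h : IsEquilibrium μ (statusExternality w) p T) {i : Fin n} {P v : ℝ}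
    (hp : p i = ENNReal.ofReal P) (hP : 0 ≤ P) (hv : 0 ≤ v)
    (hd : 0 < 1 - w i + w i * othersAbstain μ T i)
    (hPv : P ≤ v * (1 - w i + w i * othersAbstain μ T i)) :
    ENNReal.ofReal (P * (1 - cdf (μ i) v)) ≤ p i * ENNReal.ofReal (1 - extCdf (μ i) (T i)) := by
  have hi := h i
  rw [one_sub_expectedExternality, if_neg hd.ne', hp] at hi
  have hle : T i ≤ ENNReal.ofReal v := by
    rw [hi, ← ENNReal.ofReal_div_of_pos hd]
    exact ENNReal.ofReal_le_ofReal ((div_le_iff₀ hd).2 hPv)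
  have hT : T i ≠ ⊤ := ne_top_of_le_ne_top ENNReal.ofReal_ne_top hle
  have hq : extCdf (μ i) (T i) = cdf (μ i) (T i).toReal := if_neg hT
  have ht := ENNReal.toReal_le_of_le_ofReal hv hle
  rw [hp, hq, ← ENNReal.ofReal_mul hP]
  exact ENNReal.ofReal_le_ofReal
    (mul_le_mul_of_nonneg_left (by linarith [monotone_cdf (μ i) ht]) hP)

lemma revenue_ge_sum {r : Fin n → ℝ} (hr : ∀ i, 0 ≤ r i)
    (h : ∀ i, ENNReal.ofReal (r i) ≤ p i * ENNReal.ofReal (1 - extCdf (μ i) (T i))) :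
    ENNReal.ofReal (∑ i, r i) ≤ revenue μ p T := by
  rw [ENNReal.ofReal_sum_of_nonneg fun i _ => hr i]
  exact Finset.sum_le_sum fun i _ => h i

/-- The revenue in every equilibrium when agent `i` is charged her price discounted by `1 - w i`. -/
lemma IsEquilibrium.revenue_ge_discounted {P r : Fin n → ℝ}
    (h : IsEquilibrium μ (statusExternality w) (fun i => ENNReal.ofReal (P i)) T)
    (hw : ∀ i, w i ∈ Icc (0 : ℝ) 1)
    (hr : ∀ i, r i = 0 ∨ ∃ v, 0 ≤ v ∧ P i = (1 - w i) * v ∧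
      r i = (1 - w i) * v * (1 - cdf (μ i) v)) :
    ENNReal.ofReal (∑ i, r i) ≤ revenue μ (fun i => ENNReal.ofReal (P i)) T := by
  refine revenue_ge_sum (fun i => ?_) fun i => ?_
  · rcases hr i with h0 | ⟨v, hv, -, h0⟩
    · exact h0.ge
    · rw [h0]
      exact mul_nonneg (mul_nonneg (by linarith [(hw i).2]) hv) (by linarith [cdf_le_one (μ i) v])
  · rcases hr i with h0 | ⟨v, hv, hP, h0⟩
    · simp [h0]
    -- For `w i = 1` the denominator may vanish, but then the discounted price and the claimed
    -- revenue are `0`.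
    · rcases eq_or_lt_of_le (hw i).2 with h1 | h1
      · simp [h0, h1]
      · have hwQ := mul_nonneg (hw i).1 (othersAbstain_nonneg μ T i)
        rw [h0, ← hP]
        refine h.term_ge rfl (hP ▸ mul_nonneg (by linarith) hv) hv (by linarith) ?_
        rw [hP, mul_comm]
        exact mul_le_mul_of_nonneg_left (by linarith) hv

/-- The revenue in every equilibrium when all prices are at least `a * c`. -/
lemma IsEquilibrium.revenue_ge_floor {P r : Fin n → ℝ} {a c : ℝ}
    (h : IsEquilibrium μ (statusExternality w) (fun i => ENNReal.ofReal (P i)) T)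
    (hw : ∀ i, w i ∈ Icc (0 : ℝ) 1) (ha0 : 0 < a) (ha1 : a ≤ 1) (hc : 0 ≤ c)
    (hfloor : ∀ i, a * c ≤ P i)
    (hr : ∀ i, r i = 0 ∨ ∃ v, 0 ≤ v ∧ P i = a * (w i * v) ∧
      r i = w i * v * (1 - cdf (μ i) v))
    (hsum : (1 - a) * c ≤ ∑ i, r i) :
    ENNReal.ofReal (a * (1 - a) * c) ≤ revenue μ (fun i => ENNReal.ofReal (P i)) T := by
  have hac : 0 ≤ a * c := mul_nonneg ha0.le hc
  -- The product is the probability that nobody buys. If it is at least `a`, all denominators are at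
  -- least `a` and each `r i` is earned up to the factor `a`; otherwise the union bound applies to
  -- buyers who pay at least `a * c` each.
  rcases le_total a (∏ j, extCdf (μ j) (T j)) with hQ | hQ
  · have hle : a * (1 - a) * c ≤ ∑ i, a * r i := by
      rw [← Finset.mul_sum, mul_assoc]
      exact mul_le_mul_of_nonneg_left hsum ha0.le
    refine (ENNReal.ofReal_le_ofReal hle).trans (revenue_ge_sum (fun i => ?_) fun i => ?_)
    · rcases hr i with h0 | ⟨v, hv, -, h0⟩
      · simp [h0]
      · rw [h0]
        exact mul_nonneg ha0.le
          (mul_nonneg (mul_nonneg (hw i).1 hv) (by linarith [cdf_le_one (μ i) v]))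
    · rcases hr i with h0 | ⟨v, hv, hP, h0⟩
      · simp [h0]
      · have hQi := hQ.trans (prod_extCdf_le_othersAbstain μ T i)
        have hd : a ≤ 1 - w i + w i * othersAbstain μ T i := by
          have := mul_le_mul_of_nonneg_left hQi (hw i).1
          have := mul_nonneg (sub_nonneg.2 (hw i).2) (sub_nonneg.2 ha1)
          nlinarith
        have := h.term_ge (i := i) (v := v) rfl (hac.trans (hfloor i)) hv (by linarith) (by
          rw [hP]
          calc a * (w i * v) ≤ a * v :=
                mul_le_mul_of_nonneg_left (mul_le_of_le_one_left hv (hw i).2) ha0.le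
            _ ≤ _ := by rw [mul_comm]; exact mul_le_mul_of_nonneg_left hd hv)
        refine le_trans (le_of_eq ?_) this
        rw [h0, hP]
        ring_nf
  · have hle : a * (1 - a) * c ≤ ∑ i, a * c * (1 - extCdf (μ i) (T i)) := by
      have := one_sub_prod_le_sum Finset.univ (fun j => extCdf (μ j) (T j))
        (fun _ => extCdf_nonneg _ _) fun _ => extCdf_le_one _ _
      rw [← Finset.mul_sum, mul_right_comm]
      exact mul_le_mul_of_nonneg_left (by linarith) hac
    refine (ENNReal.ofReal_le_ofReal hle).trans (revenue_ge_sum (fun i => ?_) fun i => ?_)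
    · exact mul_nonneg hac (sub_nonneg.2 (extCdf_le_one _ _))
    · rw [ENNReal.ofReal_mul hac]
      gcongr
      exact hfloor i

end Equilibrium

end SocialGoods

namespace RealRAM

/-! ### Rules for running times and postconditions of programs. -/

section Rules

variable {O : ℕ → ℝ → ℝ}

/-- Started in `s`, the program halts within `τ` steps in a state that satisfies `Q`. -/
def Runs (O : ℕ → ℝ → ℝ) (c : Program) (s : State) (τ : ℕ) (Q : State → Prop) : Prop :=
  ∃ t s', Exec O c s t s' ∧ t ≤ τ ∧ Q s'

lemma Runs.mono {c : Program} {s : State} {τ τ' : ℕ} {Q Q' : State → Prop}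
    (h : Runs O c s τ Q) (hτ : τ ≤ τ') (hQ : ∀ s', Q s' → Q' s') : Runs O c s τ' Q' := by
  obtain ⟨t, s', he, ht, hq⟩ := h
  exact ⟨t, s', he, ht.trans hτ, hQ _ hq⟩

lemma Runs.skip {s : State} {τ : ℕ} {Q : State → Prop} (hτ : 1 ≤ τ) (h : Q s) :
    Runs O .skip s τ Q :=
  ⟨1, s, .skip s, hτ, h⟩

lemma Runs.setIdx {x : ℕ} {e : IdxExpr} {s : State} {τ : ℕ} {Q : State → Prop}
    (hτ : 1 + e.cost ≤ τ) (h : Q (s.setIdx x (e.eval s))) : Runs O (.setIdx x e) s τ Q :=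
  ⟨_, _, .setIdx x e s, hτ, h⟩

lemma Runs.setReal {a : ℕ} {e : IdxExpr} {r : RealExpr} {s : State} {τ : ℕ} {Q : State → Prop}
    (hτ : 1 + e.cost + r.cost ≤ τ) (h : Q (s.setReal a (e.eval s) (r.eval O s))) :
    Runs O (.setReal a e r) s τ Q :=
  ⟨_, _, .setReal a e r s, hτ, h⟩

lemma Runs.seq {c₁ c₂ : Program} {s : State} {τ₁ τ₂ : ℕ} {Q : State → Prop}
    (h : Runs O c₁ s τ₁ fun s' => Runs O c₂ s' τ₂ Q) : Runs O (.seq c₁ c₂) s (τ₁ + τ₂) Q := by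
  obtain ⟨t, s', he, ht, t', s'', he', ht', hq⟩ := h
  exact ⟨_, _, .seq he he', by omega, hq⟩

lemma Runs.branch {b : Test} {c₁ c₂ : Program} {s : State} {τ : ℕ} {Q : State → Prop}
    (h₁ : b.holds O s → Runs O c₁ s τ Q) (h₂ : ¬ b.holds O s → Runs O c₂ s τ Q) :
    Runs O (.branch b c₁ c₂) s (b.cost + τ) Q := by
  by_cases hb : b.holds O s
  · obtain ⟨t, s', he, ht, hq⟩ := h₁ hb
    exact ⟨_, _, .branch_true hb he, by omega, hq⟩
  · obtain ⟨t, s', he, ht, hq⟩ := h₂ hb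
    exact ⟨_, _, .branch_false hb he, by omega, hq⟩

/-- Runs `c` with the variable `x` equal to `0`, `1`, `2`, … as long as `x` is less than `r`. -/
def forBelow (x : ℕ) (r : RealExpr) (c : Program) : Program :=
  .seq (.setIdx x (.const 0))
    (.loop (.not (.leReal r (.cast (.var x))))
      (.seq c (.setIdx x (.add (.var x) (.const 1)))))

/-- The invariant `I k` refers to the state with the counter already set to `k`, and it must fix the
value of the bound `r`, which is evaluated anew at each test. One round costs `r.cost + 4` for the
test, `τ` for the body and `4` for the increment. -/
lemma Runs.forBelow {x : ℕ} {r : RealExpr} {c : Program} {s : State} {N τ : ℕ}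
    (I : ℕ → State → Prop) (h0 : I 0 (s.setIdx x 0))
    (hr : ∀ k s, I k s → r.eval O s = N)
    (hc : ∀ k, k < N → ∀ s, s.idx x = k → I k s →
      Runs O c s τ fun s' => s'.idx x = k ∧ I (k + 1) (s'.setIdx x (k + 1))) :
    Runs O (RealRAM.forBelow x r c) s (N * (τ + r.cost + 8) + (r.cost + 6)) (I N) := by
  have key : ∀ d k, k + d = N → ∀ s, s.idx x = k → I k s →
      Runs O (.loop (.not (.leReal r (.cast (.var x))))
        (.seq c (.setIdx x (.add (.var x) (.const 1))))) s
        (d * (τ + r.cost + 8) + (r.cost + 4)) (I N) := by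
    intro d
    induction d with
    | zero =>
      intro k hk s hs hI
      have hkN : k = N := by omega
      refine ⟨_, s, .loop_false ?_, ?_, hkN ▸ hI⟩
      · simp [Test.holds, hr k s hI, RealExpr.eval, IdxExpr.eval, hs, hkN]
      · simp only [Test.cost, RealExpr.cost, IdxExpr.cost]; omega
    | succ d ih =>
      intro k hk s hs hI
      obtain ⟨t, s', he, ht, hx, hI'⟩ := hc k (by omega) s hs hI
      have hev : (IdxExpr.add (.var x) (.const 1)).eval s' = k + 1 := by simp [IdxExpr.eval, hx]
      obtain ⟨t', s'', he', ht', hq⟩ := ih (k + 1) (by omega) (s'.setIdx x (k + 1))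
        (by simp [State.setIdx]) hI'
      refine ⟨_, s'', .loop_true ?_ (.seq he (.setIdx x _ s')) (hev.symm ▸ he'), ?_, hq⟩
      · have : k < N := by omega
        simp [Test.holds, hr k s hI, RealExpr.eval, IdxExpr.eval, hs, this]
      · simp only [Test.cost, RealExpr.cost, IdxExpr.cost]
        rw [Nat.succ_mul]
        omega
  refine (Runs.seq (Runs.setIdx (τ := 2) le_rfl
    (key N 0 (by omega) _ (by simp [State.setIdx, IdxExpr.eval]) h0))).mono (by omega) fun _ h => h

end Rules

end RealRAM

namespace SocialGoods

open RealRAM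

/-! ### Best grid price of one agent above a floor. -/

section Scan

/-- The largest expected revenue `g k * gridProb m k` over the grid prices `g k ≥ c` with `k < K`
(or `0` if there are none), and the price that attains it (or `c`). -/
noncomputable def scan (m : ℝ) (g : ℕ → ℝ) (c : ℝ) : ℕ → ℝ × ℝ
  | 0 => (0, c)
  | k + 1 =>
    open Classical in
    if c ≤ g k ∧ (scan m g c k).1 ≤ g k * gridProb m k then (g k * gridProb m k, g k)
    else scan m g c k

lemma scan_nonneg (m : ℝ) (g : ℕ → ℝ) (c : ℝ) (K : ℕ) : 0 ≤ (scan m g c K).1 := by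
  induction K with
  | zero => exact le_rfl
  | succ K ih =>
    rw [scan]
    split_ifs with h
    exacts [ih.trans h.2, ih]

lemma le_scan {m : ℝ} {g : ℕ → ℝ} {c : ℝ} {K k : ℕ} (hk : k < K) (hc : c ≤ g k) :
    g k * gridProb m k ≤ (scan m g c K).1 := by
  induction K with
  | zero => omega
  | succ K ih =>
    rw [scan]
    rcases Nat.lt_succ_iff_lt_or_eq.1 hk with h | rfl
    · split_ifs with h'
      exacts [(ih h).trans h'.2, ih h]
    · split_ifs with h'
      · exact le_rfl
      · exact le_of_not_ge fun h => h' ⟨hc, h⟩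

/-- In the default case the agent is still priced at the floor `c`, with no revenue counted: the
guarantee for floors needs every price, not only the useful ones, to be at least `c`. -/
lemma scan_spec (m : ℝ) (g : ℕ → ℝ) (c : ℝ) (K : ℕ) :
    scan m g c K = (0, c) ∨
      ∃ k < K, c ≤ g k ∧ scan m g c K = (g k * gridProb m k, g k) := by
  induction K with
  | zero => exact Or.inl rfl
  | succ K ih =>
    rw [scan]
    split_ifs with h
    · exact Or.inr ⟨K, by omega, h.1, rfl⟩
    · rcases ih with h' | ⟨k, hk, h'⟩
      exacts [Or.inl h', Or.inr ⟨k, by omega, h'⟩]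

lemma scan_antitone {m : ℝ} {g : ℕ → ℝ} {c c' : ℝ} (h : c ≤ c') (K : ℕ) :
    (scan m g c' K).1 ≤ (scan m g c K).1 := by
  rcases scan_spec m g c' K with h' | ⟨k, hk, hc, h'⟩
  · rw [h']
    exact scan_nonneg _ _ _ _
  · rw [h']
    exact le_scan hk (h.trans hc)

end Scan

/-! ### The sweep over all agents and grid points. -/

section Algorithm

/-- The grid probability with the index in the variable `x`. -/
def gridExpr (x : ℕ) : RealExpr :=
  .div (.const 10000) (.add (.const 10000) (.add (.cast (.var x)) (.const 1)))

/-- The number of grid points. -/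
def gridSize (n : ℕ) : ℕ := 100010000 * n

def gridSizeExpr : RealExpr := .mul (.const 100010000) (.cast (.var 0))

/-- Updates the best revenue and the best price (cells `0` and `1` of array `2`) of the agent in
variable `3`, whose values are multiplied by `u`, with the grid point in variable `4`; the lower
bound on the prices is in array `3`. -/
def scanStep (u : RealExpr) : Program :=
  .seq (.setReal 2 (.const 3) (.mul u (.query (.var 3) (.sub (.const 1) (gridExpr 4)))))
    (.branch (.leReal (.cell 3 (.const 0)) (.cell 2 (.const 3)))
      (.branch (.leReal (.cell 2 (.const 0)) (.mul (.cell 2 (.const 3)) (gridExpr 4)))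
        (.seq (.setReal 2 (.const 0) (.mul (.cell 2 (.const 3)) (gridExpr 4)))
          (.setReal 2 (.const 1) (.cell 2 (.const 3))))
        .skip)
      .skip)

/-- Computes the best grid prices of all agents (multiplied by `a`, in array `1`) and the sum of the
best revenues (in cell `2` of array `2`). -/
def sweep (u : RealExpr) (a : ℚ) : Program :=
  .seq (.setReal 2 (.const 2) (.const 0))
    (forBelow 3 (.cast (.var 0))
      (.seq (.setReal 2 (.const 0) (.const 0))
        (.seq (.setReal 2 (.const 1) (.cell 3 (.const 0)))
          (.seq (forBelow 4 gridSizeExpr (scanStep u))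
            (.seq (.setReal 2 (.const 2) (.add (.cell 2 (.const 2)) (.cell 2 (.const 0))))
              (.setReal 1 (.var 3) (.mul (.const a) (.cell 2 (.const 1)))))))))

variable {O : ℕ → ℝ → ℝ}

/-- The values of agent `j`, multiplied by `u`, at the grid points. -/
noncomputable def gridValue (O : ℕ → ℝ → ℝ) (u : ℝ) (j k : ℕ) : ℝ :=
  u * O j (1 - gridProb 10000 k)

/-- The states differ only in the scratch variables and arrays of a sweep. -/
def SweepFrame (s s' : State) : Prop :=
  (∀ x, x ≠ 3 → x ≠ 4 → s'.idx x = s.idx x) ∧ ∀ a, a ≠ 1 → a ≠ 2 → s'.arr a = s.arr a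

lemma eval_gridExpr (x : ℕ) (s : State) :
    (gridExpr x).eval O s = gridProb 10000 (s.idx x) := by
  simp [gridExpr, RealExpr.eval, IdxExpr.eval, gridProb]

lemma eval_gridSizeExpr {s : State} {n : ℕ} (h : s.idx 0 = n) :
    gridSizeExpr.eval O s = gridSize n := by
  simp [gridSizeExpr, gridSize, RealExpr.eval, IdxExpr.eval, h]

/-- The function `U` abstracts from the two factors in use, `w i` and `1 - w i`; both depend only on
the discount factor of the current agent. -/
lemma runs_scanStep {u : RealExpr} {U : ℝ → ℝ} (hu : ∀ s, u.eval O s = U (s.arr 0 (s.idx 3)))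
    (huc : u.cost ≤ 5) {s : State} {j k : ℕ} {c : ℝ} (hj : s.idx 3 = j) (hk : s.idx 4 = k)
    (hc : s.arr 3 0 = c)
    (hs : s.arr 2 0 = (scan 10000 (gridValue O (U (s.arr 0 j)) j) c k).1)
    (hs' : s.arr 2 1 = (scan 10000 (gridValue O (U (s.arr 0 j)) j) c k).2) :
    Runs O (scanStep u) s 100 fun s' =>
      s'.idx = s.idx ∧ (∀ a, a ≠ 2 → s'.arr a = s.arr a) ∧ s'.arr 2 2 = s.arr 2 2 ∧
      s'.arr 2 0 = (scan 10000 (gridValue O (U (s.arr 0 j)) j) c (k + 1)).1 ∧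
      s'.arr 2 1 = (scan 10000 (gridValue O (U (s.arr 0 j)) j) c (k + 1)).2 := by
  set g := gridValue O (U (s.arr 0 j)) j with hg
  have hval : (RealExpr.mul u (.query (.var 3) (.sub (.const 1) (gridExpr 4)))).eval O s = g k := by
    simp [RealExpr.eval, eval_gridExpr, IdxExpr.eval, hu, hj, hk, hg, gridValue]
  refine (Runs.seq (τ₁ := 20) (τ₂ := 80) (Runs.setReal ?_ ?_)).mono le_rfl fun _ h => h
  · simp [RealExpr.cost, IdxExpr.cost, gridExpr]; omega
  rw [hval]
  set s₁ := s.setReal 2 ((IdxExpr.const 3).eval s) (g k) with hs₁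
  have e3 : s₁.arr 2 3 = g k := by simp [hs₁, State.setReal, IdxExpr.eval]
  have e0 : s₁.arr 2 0 = s.arr 2 0 := by simp [hs₁, State.setReal, IdxExpr.eval]
  have e1 : s₁.arr 2 1 = s.arr 2 1 := by simp [hs₁, State.setReal, IdxExpr.eval]
  have e2 : s₁.arr 2 2 = s.arr 2 2 := by simp [hs₁, State.setReal, IdxExpr.eval]
  have ec : s₁.arr 3 0 = c := by simp [hs₁, State.setReal, hc]
  have ei : s₁.idx = s.idx := rfl
  have ea : ∀ a, a ≠ 2 → s₁.arr a = s.arr a := fun a ha => by simp [hs₁, State.setReal, ha]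
  have hgrid : (gridExpr 4).eval O s₁ = gridProb 10000 k := by rw [eval_gridExpr, ei, hk]
  clear_value s₁
  have same : ¬ (c ≤ g k ∧ (scan 10000 g c k).1 ≤ g k * gridProb 10000 k) →
      s₁.idx = s.idx ∧ (∀ a, a ≠ 2 → s₁.arr a = s.arr a) ∧ s₁.arr 2 2 = s.arr 2 2 ∧
      s₁.arr 2 0 = (scan 10000 g c (k + 1)).1 ∧ s₁.arr 2 1 = (scan 10000 g c (k + 1)).2 := by
    intro hn
    rw [scan, if_neg hn]
    exact ⟨ei, ea, e2, e0.trans hs, e1.trans hs'⟩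
  refine (Runs.branch (τ := 75) (fun h1 => ?_) fun h1 => ?_).mono ?_ fun _ h => h
  · simp only [Test.holds, RealExpr.eval, IdxExpr.eval, ec, e3] at h1
    refine (Runs.branch (τ := 40) (fun h2 => ?_) fun h2 => ?_).mono ?_ fun _ h => h
    · simp only [Test.holds, RealExpr.eval, IdxExpr.eval, hgrid, e0, hs, e3] at h2
      refine (Runs.seq (τ₁ := 20) (τ₂ := 20) (Runs.setReal ?_ (Runs.setReal ?_ ?_))).mono le_rfl
        fun _ h => h
      · simp [RealExpr.cost, IdxExpr.cost, gridExpr]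
      · simp [RealExpr.cost, IdxExpr.cost]
      · rw [scan, if_pos ⟨h1, h2⟩]
        refine ⟨ei, fun a ha => ?_, ?_, ?_, ?_⟩
        · simp [State.setReal, ha, ea]
        · simp [State.setReal, IdxExpr.eval, e2]
        · simp [State.setReal, IdxExpr.eval, RealExpr.eval, e3, hgrid]
        · simp [State.setReal, IdxExpr.eval, RealExpr.eval, e3]
    · simp only [Test.holds, RealExpr.eval, IdxExpr.eval, hgrid, e0, hs, e3] at h2
      exact Runs.skip (by norm_num) (same fun h => h2 h.2)
    · simp [Test.cost, RealExpr.cost, IdxExpr.cost, gridExpr]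
  · simp only [Test.holds, RealExpr.eval, IdxExpr.eval, ec, e3] at h1
    exact Runs.skip (by norm_num) (same fun h => h1 h.1)
  · simp [Test.cost, RealExpr.cost, IdxExpr.cost]

/-- The sum of the best revenues of the agents when the prices are at least `c`. -/
noncomputable def sweepTotal (O : ℕ → ℝ → ℝ) (U : ℝ → ℝ) (W : ℕ → ℝ) (n : ℕ) (c : ℝ) : ℝ :=
  ∑ j ∈ Finset.range n, (scan 10000 (gridValue O (U (W j)) j) c (gridSize n)).1

/-- A bound on the time of a sweep. -/
def sweepTime (n : ℕ) : ℕ := n * (gridSize n * 200 + 100) + 100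

lemma runs_sweep {u : RealExpr} {U : ℝ → ℝ} (hu : ∀ s, u.eval O s = U (s.arr 0 (s.idx 3)))
    (huc : u.cost ≤ 5) (a : ℚ) {s : State} {n : ℕ} {c : ℝ} (hn : s.idx 0 = n)
    (hc : s.arr 3 0 = c) :
    Runs O (sweep u a) s (sweepTime n) fun s' => SweepFrame s s' ∧
      s'.arr 2 2 = sweepTotal O U (s.arr 0) n c ∧
      ∀ j < n, s'.arr 1 j =
        a * (scan 10000 (gridValue O (U (s.arr 0 j)) j) c (gridSize n)).2 := by
  set W := s.arr 0 with hW
  set best : ℕ → ℕ → ℝ × ℝ := fun j k => scan 10000 (gridValue O (U (W j)) j) c k with hbest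
  let I : ℕ → State → Prop := fun j s' => SweepFrame s s' ∧
    s'.arr 2 2 = ∑ i ∈ Finset.range j, (best i (gridSize n)).1 ∧
    ∀ i < j, s'.arr 1 i = a * (best i (gridSize n)).2
  refine (Runs.seq (τ₁ := 10) (τ₂ := n * (gridSize n * 200 + 100) + 10)
    (Runs.setReal (by simp [RealExpr.cost, IdxExpr.cost]) ?_)).mono
    (by unfold sweepTime; omega) fun _ h => h
  refine (Runs.forBelow (N := n) (τ := gridSize n * 200 + 80) I ?_ ?_ ?_).mono ?_ fun _ h => h
  · refine ⟨⟨fun x h3 h4 => ?_, fun a h1 h2 => ?_⟩, ?_, fun i hi => by omega⟩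
    · simp [State.setIdx, State.setReal, h3]
    · simp [State.setIdx, State.setReal, h2]
    · simp [State.setIdx, State.setReal, IdxExpr.eval, RealExpr.eval]
  · intro k s' hI
    simp [RealExpr.eval, IdxExpr.eval, hI.1.1, hn]
  · intro j hj s₁ hj₁ ⟨hF, htot, hout⟩
    -- The inner invariant keeps the total and the prices of the earlier agents and adds the running
    -- optimum of agent `j`.
    let J : ℕ → State → Prop := fun k s' => SweepFrame s s' ∧ s'.idx 3 = j ∧
      s'.arr 2 2 = ∑ i ∈ Finset.range j, (best i (gridSize n)).1 ∧
      (∀ i < j, s'.arr 1 i = a * (best i (gridSize n)).2) ∧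
      s'.arr 2 0 = (best j k).1 ∧ s'.arr 2 1 = (best j k).2
    refine (Runs.seq (τ₁ := 5) (τ₂ := gridSize n * 200 + 60) (Runs.setReal
      (by simp [RealExpr.cost, IdxExpr.cost]) ?_)).mono (by omega) fun _ h => h
    refine (Runs.seq (τ₁ := 5) (τ₂ := gridSize n * 200 + 50) (Runs.setReal
      (by simp [RealExpr.cost, IdxExpr.cost]) ?_)).mono (by omega) fun _ h => h
    refine (Runs.seq (τ₁ := gridSize n * 200 + 20) (τ₂ := 30) ?_).mono (by omega) fun _ h => h
    have hloop := Runs.forBelow (O := O) (x := 4) (r := gridSizeExpr) (c := scanStep u)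
      (s := (s₁.setReal 2 0 0).setReal 2 1 c) (N := gridSize n) (τ := 100) J ?_ ?_ ?_
    · have hs₂ : ((s₁.setReal 2 ((IdxExpr.const 0).eval s₁)
          ((RealExpr.const 0).eval O s₁)).setReal 2
          ((IdxExpr.const 1).eval (s₁.setReal 2 ((IdxExpr.const 0).eval s₁)
            ((RealExpr.const 0).eval O s₁)))
          ((RealExpr.cell 3 (.const 0)).eval O (s₁.setReal 2 ((IdxExpr.const 0).eval s₁)
            ((RealExpr.const 0).eval O s₁)))) = (s₁.setReal 2 0 0).setReal 2 1 c := by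
        have h3 : s₁.arr 3 0 = c := by rw [hF.2 3 (by norm_num) (by norm_num), hc]
        simp [IdxExpr.eval, RealExpr.eval, State.setReal, h3]
      rw [hs₂]
      refine hloop.mono ?_ ?_
      · have : gridSizeExpr.cost = 4 := rfl
        rw [this]
        omega
      · intro s₂ ⟨hF₂, hj₂, htot₂, hout₂, hb0, hb1⟩
        refine (Runs.seq (τ₁ := 15) (τ₂ := 15) (Runs.setReal
          (by simp [RealExpr.cost, IdxExpr.cost]) (Runs.setReal
          (by simp [RealExpr.cost, IdxExpr.cost]) ?_))).mono (by omega) fun _ h => h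
        refine ⟨by simp [State.setReal, hj₂], ⟨fun x h3 h4 => ?_, fun a h1 h2 => ?_⟩, ?_, ?_⟩
        · simp [State.setReal, State.setIdx, h3, hF₂.1 x h3 h4]
        · simp [State.setReal, State.setIdx, h1, h2, hF₂.2 a h1 h2]
        · simp [State.setReal, State.setIdx, IdxExpr.eval, RealExpr.eval, htot₂, hb0,
            Finset.sum_range_succ]
        · intro i hi
          rcases Nat.lt_succ_iff_lt_or_eq.1 hi with h | rfl
          · have : i ≠ j := by omega
            simp [State.setReal, State.setIdx, IdxExpr.eval, hj₂, this, hout₂ i h]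
          · simp [State.setReal, State.setIdx, IdxExpr.eval, RealExpr.eval, hj₂, hb1]
    · refine ⟨⟨fun x h3 h4 => ?_, fun a h1 h2 => ?_⟩, ?_, ?_, fun i hi => ?_, ?_, ?_⟩
      · simp [State.setReal, State.setIdx, h4, hF.1 x h3 h4]
      · simp [State.setReal, State.setIdx, h2, hF.2 a h1 h2]
      · simp [State.setReal, State.setIdx, hj₁]
      · simp [State.setReal, State.setIdx, htot]
      · simp [State.setReal, State.setIdx, hout i hi]
      · simp [State.setReal, State.setIdx, hbest, scan]
      · simp [State.setReal, State.setIdx, hbest, scan]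
    · intro k s' hJ
      exact eval_gridSizeExpr (by rw [hJ.1.1 0 (by norm_num) (by norm_num), hn])
    · intro k hk s₂ hk₂ ⟨hF₂, hj₂, htot₂, hout₂, hb0, hb1⟩
      have hW₂ : s₂.arr 0 = W := hF₂.2 0 (by norm_num) (by norm_num)
      have := runs_scanStep hu huc (s := s₂) (j := j) (k := k) (c := c) hj₂ hk₂
        (by rw [hF₂.2 3 (by norm_num) (by norm_num), hc]) (by rw [hW₂, hb0]) (by rw [hW₂, hb1])
      refine this.mono le_rfl fun s₃ ⟨hi₃, ha₃, h2₃, h0₃, h1₃⟩ => ?_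
      rw [hW₂] at h0₃ h1₃
      refine ⟨by rw [hi₃, hk₂], ⟨fun x h3 h4 => ?_, fun a h1 h2 => ?_⟩, ?_, ?_, fun i hi => ?_,
        ?_, ?_⟩
      · simp [State.setIdx, h4, hi₃, hF₂.1 x h3 h4]
      · simp [State.setIdx, ha₃ a h2, hF₂.2 a h1 h2]
      · simp [State.setIdx, hi₃, hj₂]
      · simp [State.setIdx, h2₃, htot₂]
      · simp [State.setIdx, ha₃ 1 (by norm_num), hout₂ i hi]
      · simpa [State.setIdx] using h0₃
      · simpa [State.setIdx] using h1₃
  · have : (RealExpr.cast (.var 0)).cost = 2 := rfl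
    rw [this]
    exact Nat.add_le_add (Nat.mul_le_mul_left n (by omega)) (by omega)

end Algorithm

end SocialGoods

namespace SocialGoods

open RealRAM

/-! ### The search for the best floor and the complete algorithm. -/

section Search

variable {O : ℕ → ℝ → ℝ}

def discountExpr : RealExpr := .cell 0 (.var 3)

def coDiscountExpr : RealExpr := .sub (.const 1) (.cell 0 (.var 3))

/-- The factor by which prices are scaled down, an approximation of `2 - √2`. -/
def scaleFactor : ℚ := 2929 / 5000

/-- Improves the floor in cell `0` of array `4` with the candidate from the agent in variable `1`
and the grid point in variable `2`. -/
def searchStep : Program :=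
  .seq (.setReal 3 (.const 0)
      (.mul (.cell 0 (.var 1)) (.query (.var 1) (.sub (.const 1) (gridExpr 2)))))
    (.seq (sweep discountExpr scaleFactor)
      (.seq (.setReal 3 (.const 1) (.div (.cell 2 (.const 2)) (.const (1 - scaleFactor))))
        (.seq (.branch (.leReal (.cell 3 (.const 1)) (.cell 3 (.const 0)))
            (.setReal 3 (.const 0) (.cell 3 (.const 1))) .skip)
          (.branch (.leReal (.cell 4 (.const 0)) (.cell 3 (.const 0)))
            (.setReal 4 (.const 0) (.cell 3 (.const 0))) .skip))))

def search : Program :=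
  forBelow 1 (.cast (.var 0)) (forBelow 2 gridSizeExpr searchStep)

/-- Either posts scaled grid prices above the best floor, or the best grid prices discounted by
`1 - w i`, whichever has the better guarantee. -/
def pricing : Program :=
  .seq (sweep coDiscountExpr 1)
    (.seq (.setReal 4 (.const 1) (.cell 2 (.const 2)))
      (.seq search
        (.branch (.leReal (.cell 4 (.const 1))
            (.mul (.const (scaleFactor * (1 - scaleFactor))) (.cell 4 (.const 0))))
          (.seq (.setReal 3 (.const 0) (.cell 4 (.const 0))) (sweep discountExpr scaleFactor))
          (.seq (.setReal 3 (.const 0) (.const 0)) (sweep coDiscountExpr 1)))))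

lemma eval_discountExpr (s : State) : discountExpr.eval O s = id (s.arr 0 (s.idx 3)) := rfl

lemma eval_coDiscountExpr (s : State) :
    coDiscountExpr.eval O s = (fun x => 1 - x) (s.arr 0 (s.idx 3)) := by
  simp [coDiscountExpr, RealExpr.eval, IdxExpr.eval]

/-- A floor for the prices that the value of agent `i` at grid point `k` gives rise to. -/
noncomputable def candidateFloor (O : ℕ → ℝ → ℝ) (W : ℕ → ℝ) (n i k : ℕ) : ℝ :=
  min (gridValue O (W i) i k)
    (sweepTotal O id W n (gridValue O (W i) i k) / ((1 - scaleFactor : ℚ) : ℝ))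

/-- Cell `0` of array `3` is the floor read by the sweep and is afterwards lowered to the candidate.
Array `1` is absent from the conclusion because the sweep overwrites it. -/
lemma runs_searchStep {s : State} {n i k : ℕ} (hn : s.idx 0 = n) (hi : s.idx 1 = i)
    (hk : s.idx 2 = k) :
    Runs O searchStep s (sweepTime n + 100) fun s' =>
      s'.idx 0 = n ∧ s'.idx 1 = i ∧ s'.idx 2 = k ∧ s'.arr 0 = s.arr 0 ∧
      s'.arr 4 1 = s.arr 4 1 ∧
      s'.arr 4 0 = max (s.arr 4 0) (candidateFloor O (s.arr 0) n i k) := by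
  set W := s.arr 0 with hW
  set v := gridValue O (W i) i k with hv
  refine (Runs.seq (τ₁ := 20) (τ₂ := sweepTime n + 80) (Runs.setReal ?_ ?_)).mono (by omega)
    fun _ h => h
  · simp [RealExpr.cost, IdxExpr.cost, gridExpr]
  have hval : (RealExpr.mul (.cell 0 (.var 1))
      (.query (.var 1) (.sub (.const 1) (gridExpr 2)))).eval O s = v := by
    simp [RealExpr.eval, eval_gridExpr, IdxExpr.eval, hi, hk, hv, gridValue, ← hW]
  rw [hval]
  set s₁ := s.setReal 3 ((IdxExpr.const 0).eval s) v with hs₁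
  have f1 : s₁.arr 3 0 = v := by simp [hs₁, State.setReal, IdxExpr.eval]
  have f2 : s₁.arr 0 = W := by simp [hs₁, State.setReal, hW]
  have f3 : s₁.arr 4 = s.arr 4 := by simp [hs₁, State.setReal]
  have f4 : s₁.idx = s.idx := rfl
  clear_value s₁
  refine Runs.seq (τ₁ := sweepTime n) (τ₂ := 80) ((runs_sweep eval_discountExpr
    (by simp [discountExpr, RealExpr.cost, IdxExpr.cost]) scaleFactor (by rw [f4, hn])
    f1).mono le_rfl ?_)
  rintro s₂ ⟨⟨hi₂, ha₂⟩, htot, -⟩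
  rw [f2] at htot
  have g1 : s₂.arr 3 0 = v := by rw [ha₂ 3 (by norm_num) (by norm_num), f1]
  have g2 : s₂.arr 0 = W := by rw [ha₂ 0 (by norm_num) (by norm_num), f2]
  have g3 : s₂.arr 4 = s.arr 4 := by rw [ha₂ 4 (by norm_num) (by norm_num), f3]
  have g4 : s₂.idx 0 = n := by rw [hi₂ 0 (by norm_num) (by norm_num), f4, hn]
  have g5 : s₂.idx 1 = i := by rw [hi₂ 1 (by norm_num) (by norm_num), f4, hi]
  have g6 : s₂.idx 2 = k := by rw [hi₂ 2 (by norm_num) (by norm_num), f4, hk]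
  refine (Runs.seq (τ₁ := 20) (τ₂ := 60) (Runs.setReal ?_ ?_)).mono le_rfl fun _ h => h
  · simp [RealExpr.cost, IdxExpr.cost]
  set d := sweepTotal O id W n v / ((1 - scaleFactor : ℚ) : ℝ) with hd
  have hval₂ : (RealExpr.div (.cell 2 (.const 2)) (.const (1 - scaleFactor))).eval O s₂ = d := by
    simp only [RealExpr.eval, IdxExpr.eval, htot, hd]
  rw [hval₂]
  set s₃ := s₂.setReal 3 ((IdxExpr.const 1).eval s₂) d with hs₃
  have k0 : s₃.arr 3 1 = d := by simp [hs₃, State.setReal, IdxExpr.eval]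
  have k1 : s₃.arr 3 0 = v := by simp [hs₃, State.setReal, IdxExpr.eval, g1]
  have k2 : s₃.arr 0 = W := by simp [hs₃, State.setReal, g2]
  have k3 : s₃.arr 4 = s.arr 4 := by simp [hs₃, State.setReal, g3]
  have k4 : s₃.idx = s₂.idx := rfl
  clear_value s₃
  rw [← k4] at g4 g5 g6
  have hmin : Runs O (.branch (.leReal (.cell 3 (.const 1)) (.cell 3 (.const 0)))
      (.setReal 3 (.const 0) (.cell 3 (.const 1))) .skip) s₃ 30 fun s' => s'.idx = s₃.idx ∧
      s'.arr 0 = W ∧ s'.arr 4 = s.arr 4 ∧ s'.arr 3 0 = min v d := by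
    refine (Runs.branch (τ := 10) (fun h => ?_) fun h => ?_).mono ?_ fun _ h => h
    · simp only [Test.holds, RealExpr.eval, IdxExpr.eval, k0, k1] at h
      refine Runs.setReal (by simp [RealExpr.cost, IdxExpr.cost]) ⟨rfl, ?_, ?_, ?_⟩
      · simp [State.setReal, k2]
      · simp [State.setReal, k3]
      · simp [State.setReal, IdxExpr.eval, RealExpr.eval, k0, h]
    · simp only [Test.holds, RealExpr.eval, IdxExpr.eval, k0, k1] at h
      exact Runs.skip (by norm_num) ⟨rfl, k2, k3, by rw [k1, min_eq_left (not_le.1 h).le]⟩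
    · simp [Test.cost, RealExpr.cost, IdxExpr.cost]
  refine (Runs.seq (τ₁ := 30) (τ₂ := 30) (hmin.mono le_rfl ?_)).mono le_rfl fun _ h => h
  rintro s₄ ⟨l1, l2, l3, l4⟩
  refine (Runs.branch (τ := 10) (fun h => ?_) fun h => ?_).mono ?_ fun _ h => h
  · simp only [Test.holds, RealExpr.eval, IdxExpr.eval, l3, l4] at h
    refine Runs.setReal (by simp [RealExpr.cost, IdxExpr.cost]) ⟨?_, ?_, ?_, ?_, ?_, ?_⟩
    · simp [State.setReal, l1, g4]
    · simp [State.setReal, l1, g5]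
    · simp [State.setReal, l1, g6]
    · simp [State.setReal, l2]
    · simp [State.setReal, IdxExpr.eval, l3]
    · rw [candidateFloor, max_eq_right h]
      simp [State.setReal, IdxExpr.eval, RealExpr.eval, l4]
  · simp only [Test.holds, RealExpr.eval, IdxExpr.eval, l3, l4] at h
    refine Runs.skip (by norm_num) ⟨by rw [l1, g4], by rw [l1, g5], by rw [l1, g6], l2, by rw [l3],
      ?_⟩
    rw [candidateFloor, max_eq_left (not_le.1 h).le, l3]
  · simp [Test.cost, RealExpr.cost, IdxExpr.cost]

/-- The floor `c` is the largest candidate, or `0` if no candidate is positive. -/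
def IsBestFloor (O : ℕ → ℝ → ℝ) (W : ℕ → ℝ) (n : ℕ) (c : ℝ) : Prop :=
  0 ≤ c ∧ (c = 0 ∨ ∃ i k, c = candidateFloor O W n i k) ∧
    ∀ i < n, ∀ k < gridSize n, candidateFloor O W n i k ≤ c

/-- A bound on the time of the search. -/
def searchTime (n : ℕ) : ℕ := n * (gridSize n * (sweepTime n + 200) + 100) + 100

lemma runs_search {s : State} {n : ℕ} (hn : s.idx 0 = n) (h0 : s.arr 4 0 = 0) :
    Runs O search s (searchTime n) fun s' => s'.idx 0 = n ∧ s'.arr 0 = s.arr 0 ∧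
      s'.arr 4 1 = s.arr 4 1 ∧ IsBestFloor O (s.arr 0) n (s'.arr 4 0) := by
  set W := s.arr 0 with hW
  let base : State → Prop := fun s' => s'.idx 0 = n ∧ s'.arr 0 = W ∧ s'.arr 4 1 = s.arr 4 1 ∧
    0 ≤ s'.arr 4 0 ∧ (s'.arr 4 0 = 0 ∨ ∃ i k, s'.arr 4 0 = candidateFloor O W n i k)
  let I : ℕ → State → Prop := fun i s' => base s' ∧
    ∀ i' < i, ∀ k < gridSize n, candidateFloor O W n i' k ≤ s'.arr 4 0
  refine (Runs.forBelow (N := n) (τ := gridSize n * (sweepTime n + 200) + 50) I ?_ ?_ ?_).mono ?_ ?_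
  · refine ⟨⟨?_, ?_, ?_, ?_, Or.inl ?_⟩, fun i hi => by omega⟩
    · simp [State.setIdx, hn]
    · simp [State.setIdx, hW]
    · simp [State.setIdx]
    · simp [State.setIdx, h0]
    · simp [State.setIdx, h0]
  · intro k s' hI
    simp [RealExpr.eval, IdxExpr.eval, hI.1.1]
  · intro i hi s₁ hi₁ ⟨hb, hI⟩
    let J : ℕ → State → Prop := fun k s' => I i s' ∧ s'.idx 1 = i ∧
      ∀ k' < k, candidateFloor O W n i k' ≤ s'.arr 4 0
    refine (Runs.forBelow (N := gridSize n) (τ := sweepTime n + 100) J ?_ ?_ ?_).mono ?_ ?_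
    · exact ⟨⟨⟨by simp [State.setIdx, hb.1], hb.2⟩, hI⟩, by simp [State.setIdx, hi₁],
        fun k hk => by omega⟩
    · exact fun k s' hJ => eval_gridSizeExpr hJ.1.1.1
    · intro k hk s₂ hk₂ ⟨⟨⟨hn₂, hW₂, hA₂, hnn, hex⟩, hI₂⟩, hi₂, hle⟩
      refine (runs_searchStep hn₂ hi₂ hk₂).mono le_rfl ?_
      rintro s₃ ⟨m0, m1, m2, m3, m4, m5⟩
      rw [hW₂] at m3 m5
      have hmono : s₂.arr 4 0 ≤ s₃.arr 4 0 := by rw [m5]; exact le_max_left _ _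
      refine ⟨m2, ⟨⟨⟨by simp [State.setIdx, m0], m3, m4.trans hA₂, hnn.trans hmono, ?_⟩,
        fun i' hi' k' hk' => (hI₂ i' hi' k' hk').trans hmono⟩, by simp [State.setIdx, m1],
        fun k' hk' => ?_⟩⟩
      · change s₃.arr 4 0 = 0 ∨ ∃ i k, s₃.arr 4 0 = candidateFloor O W n i k
        rw [m5]
        rcases max_choice (s₂.arr 4 0) (candidateFloor O W n i k) with h | h
        · rw [h]; exact hex
        · rw [h]; exact Or.inr ⟨i, k, rfl⟩
      · rcases Nat.lt_succ_iff_lt_or_eq.1 hk' with h | rfl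
        · exact (hle k' h).trans hmono
        · change _ ≤ s₃.arr 4 0
          rw [m5]
          exact le_max_right _ _
    · have : gridSizeExpr.cost = 4 := rfl
      rw [this]
      exact Nat.add_le_add (Nat.mul_le_mul_left _ (by omega)) (by omega)
    · rintro s₂ ⟨⟨⟨hn₂, hb₂⟩, hI₂⟩, hi₂, hle⟩
      refine ⟨hi₂, ⟨by simp [State.setIdx, hn₂], hb₂⟩, fun i' hi' k hk => ?_⟩
      rcases Nat.lt_succ_iff_lt_or_eq.1 hi' with h | rfl
      · exact hI₂ i' h k hk
      · exact hle k hk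
  · have : (RealExpr.cast (.var 0)).cost = 2 := rfl
    rw [this, searchTime]
    exact Nat.add_le_add (Nat.mul_le_mul_left n (by omega)) (by omega)
  · rintro s' ⟨⟨a1, a2, a3, a4, a5⟩, a6⟩
    exact ⟨a1, a2, a3, a4, a5, a6⟩

/-- A bound on the time of the algorithm. -/
def pricingTime (n : ℕ) : ℕ := 2 * sweepTime n + searchTime n + 100

lemma runs_pricing {s : State} {n : ℕ} (hn : s.idx 0 = n) (h3 : s.arr 3 0 = 0)
    (h4 : s.arr 4 0 = 0) :
    Runs O pricing s (pricingTime n) fun s' => ∃ c, IsBestFloor O (s.arr 0) n c ∧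
      ((sweepTotal O (fun x => 1 - x) (s.arr 0) n 0 ≤
            ((scaleFactor * (1 - scaleFactor) : ℚ) : ℝ) * c ∧
          ∀ j < n, s'.arr 1 j =
            scaleFactor * (scan 10000 (gridValue O (s.arr 0 j) j) c (gridSize n)).2) ∨
        (((scaleFactor * (1 - scaleFactor) : ℚ) : ℝ) * c ≤
            sweepTotal O (fun x => 1 - x) (s.arr 0) n 0 ∧
          ∀ j < n, s'.arr 1 j =
            (scan 10000 (gridValue O (1 - s.arr 0 j) j) 0 (gridSize n)).2)) := by
  set W := s.arr 0 with hW
  refine (Runs.seq (τ₁ := sweepTime n) (τ₂ := sweepTime n + searchTime n + 100)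
    ((runs_sweep eval_coDiscountExpr
    (by simp [coDiscountExpr, RealExpr.cost, IdxExpr.cost]) 1 hn h3).mono le_rfl ?_)).mono
    (by unfold pricingTime; omega) fun _ h => h
  rintro s₁ ⟨⟨hi₁, ha₁⟩, htot, -⟩
  refine (Runs.seq (τ₁ := 10) (τ₂ := sweepTime n + searchTime n + 80) (Runs.setReal ?_ ?_)).mono
    (by omega) fun _ h => h
  · simp [RealExpr.cost, IdxExpr.cost]
  set s₂ := s₁.setReal 4 ((IdxExpr.const 1).eval s₁) ((RealExpr.cell 2 (.const 2)).eval O s₁) with hs₂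
  have b1 : s₂.arr 4 1 = sweepTotal O (fun x => 1 - x) W n 0 := by
    simp [hs₂, State.setReal, IdxExpr.eval, RealExpr.eval, htot, hW]
  have b2 : s₂.arr 4 0 = 0 := by
    simp [hs₂, State.setReal, IdxExpr.eval, ha₁, h4]
  have b3 : s₂.arr 0 = W := by simp [hs₂, State.setReal, ha₁, hW]
  have b4 : s₂.idx 0 = n := by simp [hs₂, State.setReal, hi₁, hn]
  clear_value s₂
  refine (Runs.seq (τ₁ := searchTime n) (τ₂ := sweepTime n + 80)
    ((runs_search b4 b2).mono le_rfl ?_)).mono (by omega) fun _ h => h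
  rintro s₃ ⟨c1, c2, c3, c4⟩
  rw [b3] at c2 c4
  rw [b1] at c3
  refine (Runs.branch (τ := sweepTime n + 40) (fun h => ?_) fun h => ?_).mono ?_ fun _ h => h
  · simp only [Test.holds, RealExpr.eval, IdxExpr.eval, c3] at h
    refine (Runs.seq (τ₁ := 10) (τ₂ := sweepTime n) (Runs.setReal ?_
      ((runs_sweep (c := s₃.arr 4 0) eval_discountExpr
        (by simp [discountExpr, RealExpr.cost, IdxExpr.cost]) scaleFactor ?_ ?_).mono
        le_rfl ?_))).mono (by omega) fun _ h => h
    · simp [RealExpr.cost, IdxExpr.cost]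
    · simp [State.setReal, c1]
    · simp [State.setReal, IdxExpr.eval, RealExpr.eval]
    · rintro s₄ ⟨-, -, hout⟩
      refine ⟨_, c4, Or.inl ⟨h, fun j hj => ?_⟩⟩
      rw [hout j hj]
      simp [State.setReal, c2]
  · simp only [Test.holds, RealExpr.eval, IdxExpr.eval, c3] at h
    -- The search has overwritten both the floor and the prices of the first sweep, so the floor is
    -- reset to `0` and the discounted prices are computed again.
    refine (Runs.seq (τ₁ := 10) (τ₂ := sweepTime n) (Runs.setReal ?_
      ((runs_sweep (c := 0) eval_coDiscountExpr
        (by simp [coDiscountExpr, RealExpr.cost, IdxExpr.cost]) 1 ?_ ?_).mono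
        le_rfl ?_))).mono (by omega) fun _ h => h
    · simp [RealExpr.cost, IdxExpr.cost]
    · simp [State.setReal, c1]
    · simp [State.setReal, IdxExpr.eval, RealExpr.eval]
    · rintro s₄ ⟨-, -, hout⟩
      refine ⟨_, c4, Or.inr ⟨(not_le.1 h).le, fun j hj => ?_⟩⟩
      rw [hout j hj]
      simp [State.setReal, c2]
  · simp [Test.cost, RealExpr.cost, IdxExpr.cost]
    omega

/-- The bound on the time of the algorithm as a polynomial. -/
noncomputable def pricingTimePolynomial : Polynomial ℕ :=
  let K : Polynomial ℕ := 100010000 * .X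
  let S : Polynomial ℕ := .X * (K * 200 + 100) + 100
  2 * S + (.X * (K * (S + 200) + 100) + 100) + 100

lemma eval_pricingTimePolynomial (n : ℕ) : pricingTimePolynomial.eval n = pricingTime n := by
  simp [pricingTimePolynomial, pricingTime, searchTime, sweepTime, gridSize]

end Search

end SocialGoods

namespace SocialGoods

open RealRAM

/-! ### Comparison of the computed prices with the optimum. -/

section Guarantee

variable {O : ℕ → ℝ → ℝ} {W : ℕ → ℝ} {n : ℕ} {c : ℝ}

lemma sweepTotal_nonneg (O : ℕ → ℝ → ℝ) (U : ℝ → ℝ) (W : ℕ → ℝ) (n : ℕ) (c : ℝ) :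
    0 ≤ sweepTotal O U W n c :=
  Finset.sum_nonneg fun _ _ => scan_nonneg _ _ _ _

lemma sweepTotal_antitone (O : ℕ → ℝ → ℝ) (U : ℝ → ℝ) (W : ℕ → ℝ) (n : ℕ) :
    Antitone (sweepTotal O U W n) :=
  fun _ _ h => Finset.sum_le_sum fun _ _ => scan_antitone h _

/-- A candidate is at most its grid value `v` and at most the total at `v` divided by `1 -
scaleFactor`; lowering the floor from `v` to `c` can only raise the total. -/
lemma IsBestFloor.le_sweepTotal (h : IsBestFloor O W n c) :
    (1 - (scaleFactor : ℝ)) * c ≤ sweepTotal O id W n c := by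
  obtain ⟨-, rfl | ⟨i, k, hc⟩, -⟩ := h
  · rw [mul_zero]
    exact sweepTotal_nonneg _ _ _ _ _
  · have h1 : c ≤ gridValue O (W i) i k := hc.trans_le (min_le_left _ _)
    have h2 := hc.trans_le (min_le_right _ _)
    have hpos : (0 : ℝ) < ((1 - scaleFactor : ℚ) : ℝ) := by norm_num [scaleFactor]
    rw [le_div_iff₀ hpos] at h2
    push_cast at h2
    have := sweepTotal_antitone O id W n h1
    linarith

/-- The floor `c'` can be raised, without lowering the total, to the least grid value `v` that earns
revenue under it. The candidate of `v` is at most `c < v`, so its minimum is attained by the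
quotient, which bounds the total at `v`. -/
lemma IsBestFloor.sweepTotal_le (h : IsBestFloor O W n c) {c' : ℝ} (hc : c < c') :
    sweepTotal O id W n c' ≤ (1 - (scaleFactor : ℝ)) * c := by
  classical
  obtain ⟨hc0, -, hmax⟩ := h
  have hpos : (0 : ℝ) < ((1 - scaleFactor : ℚ) : ℝ) := by norm_num [scaleFactor]
  set best : ℕ → ℝ × ℝ := fun j => scan 10000 (gridValue O (W j) j) c' (gridSize n) with hbest
  set J := (Finset.range n).filter fun j => 0 < (best j).1 with hJ
  rcases J.eq_empty_or_nonempty with hE | hne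
  · have hzero : sweepTotal O id W n c' ≤ 0 := by
      refine Finset.sum_nonpos fun j hj => ?_
      by_contra hlt
      have : j ∈ J := Finset.mem_filter.2 ⟨hj, not_le.1 hlt⟩
      rw [hE] at this
      simp at this
    have : (0 : ℝ) ≤ (1 - (scaleFactor : ℝ)) * c := by
      push_cast at hpos
      exact mul_nonneg hpos.le hc0
    linarith
  · obtain ⟨i, hi, hmin⟩ := Finset.exists_min_image J (fun j => (best j).2) hne
    have hspec : ∀ j ∈ J, ∃ k < gridSize n, c' ≤ gridValue O (W j) j k ∧
        best j = (gridValue O (W j) j k * gridProb 10000 k, gridValue O (W j) j k) := by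
      intro j hj
      rcases scan_spec 10000 (gridValue O (W j) j) c' (gridSize n) with h0 | h1
      · have := (Finset.mem_filter.1 hj).2
        simp [hbest, h0] at this
      · exact h1
    obtain ⟨k, hk, hck, hbi⟩ := hspec i hi
    have hin := Finset.mem_range.1 (Finset.mem_filter.1 hi).1
    set v := gridValue O (W i) i k with hv
    have hle : sweepTotal O id W n c' ≤ sweepTotal O id W n v := by
      refine Finset.sum_le_sum fun j hj => ?_
      by_cases hjJ : j ∈ J
      · obtain ⟨k', hk', -, hbj⟩ := hspec j hjJ
        have h1 := hmin j hjJ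
        rw [hbi, hbj] at h1
        change (best j).1 ≤ _
        rw [hbj]
        exact le_scan hk' h1
      · have : (best j).1 ≤ 0 := by
          by_contra hlt
          exact hjJ (Finset.mem_filter.2 ⟨hj, not_le.1 hlt⟩)
        exact this.trans (scan_nonneg _ _ _ _)
    have h1 := hmax i hin k hk
    unfold candidateFloor at h1
    rcases min_le_iff.1 h1 with h2 | h2
    · exact absurd h2 (not_le.2 (hc.trans_le hck))
    · rw [div_le_iff₀ hpos] at h2
      push_cast at h2
      linarith

variable {μ : Fin n → Measure ℝ} {w : Fin n → ℝ}

lemma initialState_weight (w : Fin n → ℝ) (i : Fin n) : (initialState w).arr 0 i = w i := by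
  simp [initialState]

lemma gridValue_quantileOracle (μ : Fin n → Measure ℝ) (u : ℝ) (i : Fin n) (k : ℕ) :
    gridValue (quantileOracle μ) u i k = u * quantile (μ i) (1 - gridProb 10000 k) := by
  simp [gridValue, quantileOracle]

lemma sweepTotal_eq_sum_fin (μ : Fin n → Measure ℝ) (U : ℝ → ℝ) (w : Fin n → ℝ) (c : ℝ) :
    sweepTotal (quantileOracle μ) U ((initialState w).arr 0) n c =
      ∑ i : Fin n, (scan 10000 (gridValue (quantileOracle μ) (U (w i)) i) c (gridSize n)).1 := by
  rw [sweepTotal, Finset.sum_range]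
  simp only [initialState_weight]

/-- The revenue from an agent at prices above the floor `c` in terms of the best grid price. -/
lemma mul_revenue_le_scan {i : Fin n} [IsProbabilityMeasure (μ i)] (h0 : μ i (Iio 0) = 0)
    (hreg : IsRegular (μ i)) {u T : ℝ} (hu : 0 ≤ u) (hc : 0 ≤ c) (hT : 0 ≤ T) (hcT : c ≤ u * T) :
    u * (T * (1 - cdf (μ i) T)) ≤
      10001 / 10000 * (scan 10000 (gridValue (quantileOracle μ) u i) c (gridSize n)).1 +
        c / (10000 * n) := by
  have hn : 0 < n := i.pos
  have hn1 : (1 : ℝ) ≤ n := by exact_mod_cast hn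
  have hKc : (gridSize n : ℝ) = 100010000 * n := by unfold gridSize; push_cast; ring
  have hKn : 0 < gridSize n := by unfold gridSize; omega
  have hKm : (10000 : ℝ) * 10000 ≤ gridSize n := by rw [hKc]; linarith
  obtain ⟨k, hk, hle, hor⟩ := exists_grid_price hreg h0 (m := 10000) (by norm_num) hKn hKm hT
  have hle' : u * (T * (1 - cdf (μ i) T)) ≤
      10001 / 10000 * (gridValue (quantileOracle μ) u i k * gridProb 10000 k) := by
    rw [gridValue_quantileOracle]
    refine (mul_le_mul_of_nonneg_left hle hu).trans (le_of_eq ?_)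
    ring
  have hcn : 0 ≤ c / (10000 * n) := by positivity
  by_cases hck : c ≤ gridValue (quantileOracle μ) u i k
  · have := le_scan (m := 10000) hk hck
    linarith
  · have hkK : k + 1 = gridSize n := by
      -- A matched price above `T` would be above the floor, so only the last grid point can fall
      -- below it.
      refine hor.resolve_left fun hTv => hck (hcT.trans ?_)
      rw [gridValue_quantileOracle]
      exact mul_le_mul_of_nonneg_left hTv hu
    have hy : gridProb 10000 k = 10000 / (10000 + 100010000 * n) := by
      have : (k : ℝ) + 1 = 100010000 * n := by rw [← hKc, ← hkK]; push_cast; ring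
      rw [gridProb, this]
    have hy0 : 0 ≤ gridProb 10000 k := by rw [hy]; positivity
    have h1 : gridValue (quantileOracle μ) u i k * gridProb 10000 k ≤ c * gridProb 10000 k :=
      mul_le_mul_of_nonneg_right (not_le.1 hck).le hy0
    -- The grid size `10000 * 10001 * n` is chosen for this bound: the losses of all `n` agents
    -- together are at most `c / 10000`.
    have h2 : 10001 / 10000 * gridProb 10000 k ≤ 1 / (10000 * n) := by
      rw [hy, div_mul_div_comm, div_le_div_iff₀ (by positivity) (by positivity)]
      linarith
    have h3 := mul_le_mul_of_nonneg_left h2 hc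
    have h4 := scan_nonneg 10000 (gridValue (quantileOracle μ) u i) c (gridSize n)
    calc u * (T * (1 - cdf (μ i) T))
        ≤ 10001 / 10000 * (gridValue (quantileOracle μ) u i k * gridProb 10000 k) := hle'
      _ ≤ c * (10001 / 10000 * gridProb 10000 k) := by linarith
      _ ≤ c / (10000 * n) := by rw [div_eq_mul_one_div c]; exact h3
      _ ≤ _ := by linarith

/-- The bound `A + B c' + c'` is used with `c'` slightly above the best floor `c`, where `B c'` has
dropped to `(1 - scaleFactor) * c`. At `c` itself `B` may be larger, hence the passage to the limit.
-/
lemma optimalRevenue_le (hμ : ∀ i, IsProbabilityMeasure (μ i)) (h0 : ∀ i, μ i (Iio 0) = 0)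
    (hreg : ∀ i, IsRegular (μ i)) (hw : ∀ i, w i ∈ Icc (0 : ℝ) 1)
    (hc : IsBestFloor (quantileOracle μ) ((initialState w).arr 0) n c) :
    optimalRevenue μ (statusExternality w) ≤ ENNReal.ofReal (10001 / 10000 *
      (sweepTotal (quantileOracle μ) (fun x => 1 - x) ((initialState w).arr 0) n 0 +
        (2 - scaleFactor) * c)) := by
  set O := quantileOracle μ
  set A := sweepTotal O (fun x => 1 - x) ((initialState w).arr 0) n 0 with hA
  have hA0 : 0 ≤ A := sweepTotal_nonneg _ _ _ _ _
  have hs : (scaleFactor : ℝ) = 2929 / 5000 := by norm_num [scaleFactor]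
  have hc0 := hc.1
  refine iSup_le fun p => iSup_le fun T => iSup_le fun hT => ?_
  have key : ∀ c' : ℝ, c < c' → revenue μ p T ≤
      ENNReal.ofReal (10001 / 10000 * (A + (1 - scaleFactor) * c + c')) := by
    intro c' hc'
    have hc'0 : 0 ≤ c' := hc0.trans hc'.le
    refine (hT.revenue_le hw
      (A := fun i => 10001 / 10000 * (scan 10000 (gridValue O (1 - w i) i) 0 (gridSize n)).1)
      (B := fun i => 10001 / 10000 * (scan 10000 (gridValue O (w i) i) c' (gridSize n)).1 +
        c' / (10000 * n)) (c := c') (fun i t ht => ?_) (fun i => ?_) (fun i t ht hct => ?_)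
        hc'0).trans (ENNReal.ofReal_le_ofReal ?_)
    · have := mul_revenue_le_scan (h0 i) (hreg i) (u := 1 - w i) (by linarith [(hw i).2]) le_rfl ht
        (mul_nonneg (by linarith [(hw i).2]) ht)
      rwa [zero_div, add_zero] at this
    · have := scan_nonneg 10000 (gridValue O (w i) i) c' (gridSize n)
      positivity
    · exact mul_revenue_le_scan (h0 i) (hreg i) (hw i).1 hc'0 ht hct
    · have hG := hc.sweepTotal_le hc'
      rw [sweepTotal_eq_sum_fin] at hA hG
      rw [Finset.sum_add_distrib, ← Finset.mul_sum, ← Finset.mul_sum, ← hA, Finset.sum_const,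
        Finset.card_univ, Fintype.card_fin, nsmul_eq_mul]
      have hn : (n : ℝ) * (c' / (10000 * n)) ≤ c' / 10000 := by
        rcases Nat.eq_zero_or_pos n with hn | hn
        · simp only [hn, Nat.cast_zero, zero_mul]; positivity
        · have : (0 : ℝ) < n := by exact_mod_cast hn
          refine le_of_eq ?_
          field_simp
      simp only [id] at hG
      linarith
  have hpos : ∀ c' : ℝ, c ≤ c' → 0 ≤ 10001 / 10000 * (A + (1 - scaleFactor) * c + c') := by
    intro c' hc'
    rw [hs]
    linarith
  have hfin : revenue μ p T ≠ ⊤ := ne_top_of_le_ne_top ENNReal.ofReal_ne_top (key (c + 1) (by linarith))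
  rw [← ENNReal.ofReal_toReal hfin]
  refine ENNReal.ofReal_le_ofReal (le_of_forall_pos_le_add fun ε hε => ?_)
  have := ENNReal.toReal_le_of_le_ofReal (hpos (c + ε / 2) (by linarith))
    (key (c + ε / 2) (by linarith))
  linarith

lemma one_sub_cdf_quantile_grid {ν : Measure ℝ} [IsProbabilityMeasure ν] (h0 : ν (Iio 0) = 0)
    (hreg : IsRegular ν) (k : ℕ) :
    1 - cdf ν (quantile ν (1 - gridProb 10000 k)) = gridProb 10000 k := by
  have hy0 : 0 < gridProb 10000 k := by unfold gridProb; positivity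
  have hy1 : gridProb 10000 k < 1 := by
    unfold gridProb
    rw [div_lt_one (by positivity)]
    have : (0 : ℝ) ≤ k := Nat.cast_nonneg k
    linarith
  rw [(quantile_spec hreg h0 (by linarith) (by linarith)).2]
  ring

/-- Turns grid data into a value with its true selling probability. The two cases match the
alternatives for `r i` in the revenue bounds. -/
lemma scan_agent (h0 : ∀ i, μ i (Iio 0) = 0) (hμ : ∀ i, IsProbabilityMeasure (μ i))
    (hreg : ∀ i, IsRegular (μ i)) (u c : ℝ) (i : Fin n) (K : ℕ) :
    scan 10000 (gridValue (quantileOracle μ) u i) c K = (0, c) ∨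
      ∃ v, 0 ≤ v ∧ c ≤ u * v ∧
        scan 10000 (gridValue (quantileOracle μ) u i) c K = (u * v * (1 - cdf (μ i) v), u * v) := by
  rcases scan_spec 10000 (gridValue (quantileOracle μ) u i) c K with h | ⟨k, -, hck, h⟩
  · exact Or.inl h
  · rw [gridValue_quantileOracle] at hck h
    refine Or.inr ⟨_, quantile_nonneg (hreg i) (h0 i) _, hck, ?_⟩
    rw [h, one_sub_cdf_quantile_grid (h0 i) (hreg i)]

lemma revenue_ge_of_scaled (hμ : ∀ i, IsProbabilityMeasure (μ i)) (h0 : ∀ i, μ i (Iio 0) = 0)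
    (hreg : ∀ i, IsRegular (μ i)) (hw : ∀ i, w i ∈ Icc (0 : ℝ) 1)
    (hc : IsBestFloor (quantileOracle μ) ((initialState w).arr 0) n c) {P : Fin n → ℝ}
    (hP : ∀ i : Fin n, P i = scaleFactor *
      (scan 10000 (gridValue (quantileOracle μ) (w i) i) c (gridSize n)).2) :
    (∀ i, 0 ≤ P i) ∧ ∀ T, IsEquilibrium μ (statusExternality w) (fun i => ENNReal.ofReal (P i)) T →
      ENNReal.ofReal (scaleFactor * (1 - scaleFactor) * c) ≤
        revenue μ (fun i => ENNReal.ofReal (P i)) T := by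
  have hs : (scaleFactor : ℝ) = 2929 / 5000 := by norm_num [scaleFactor]
  have hs0 : (0 : ℝ) < scaleFactor := by rw [hs]; norm_num
  have hfloor : ∀ i, scaleFactor * c ≤ P i := by
    intro i
    rw [hP i]
    refine mul_le_mul_of_nonneg_left ?_ hs0.le
    rcases scan_agent h0 hμ hreg (w i) c i (gridSize n) with h | ⟨v, -, hcv, h⟩
    · rw [h]
    · rw [h]; exact hcv
  refine ⟨fun i => (mul_nonneg hs0.le hc.1).trans (hfloor i), fun T hT => ?_⟩
  refine hT.revenue_ge_floor hw hs0 (by rw [hs]; norm_num) hc.1 hfloor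
    (r := fun i => (scan 10000 (gridValue (quantileOracle μ) (w i) i) c (gridSize n)).1)
    (fun i => ?_) ?_
  · rcases scan_agent h0 hμ hreg (w i) c i (gridSize n) with h | ⟨v, hv, -, h⟩
    · left; rw [h]
    · right; exact ⟨v, hv, by rw [hP i, h], by rw [h]⟩
  · have := hc.le_sweepTotal
    rwa [sweepTotal_eq_sum_fin] at this

lemma revenue_ge_of_discounted (hμ : ∀ i, IsProbabilityMeasure (μ i))
    (h0 : ∀ i, μ i (Iio 0) = 0) (hreg : ∀ i, IsRegular (μ i)) (hw : ∀ i, w i ∈ Icc (0 : ℝ) 1)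
    {P : Fin n → ℝ}
    (hP : ∀ i : Fin n, P i =
      (scan 10000 (gridValue (quantileOracle μ) (1 - w i) i) 0 (gridSize n)).2) :
    (∀ i, 0 ≤ P i) ∧ ∀ T, IsEquilibrium μ (statusExternality w) (fun i => ENNReal.ofReal (P i)) T →
      ENNReal.ofReal
          (sweepTotal (quantileOracle μ) (fun x => 1 - x) ((initialState w).arr 0) n 0) ≤
        revenue μ (fun i => ENNReal.ofReal (P i)) T := by
  refine ⟨fun i => ?_, fun T hT => ?_⟩
  · rw [hP i]
    rcases scan_agent h0 hμ hreg (1 - w i) 0 i (gridSize n) with h | ⟨v, -, hcv, h⟩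
    · rw [h]
    · rw [h]; exact hcv
  · rw [sweepTotal_eq_sum_fin]
    refine hT.revenue_ge_discounted hw fun i => ?_
    rcases scan_agent h0 hμ hreg (1 - w i) 0 i (gridSize n) with h | ⟨v, hv, -, h⟩
    · left; rw [h]
    · right; exact ⟨v, hv, by rw [hP i, h], by rw [h]⟩

end Guarantee

end SocialGoods

/-! ### The approximation factor. -/

theorem mainTheorem7 :
    ∃ (alg : RealRAM.Program) (P : Polynomial ℕ),
      ∀ (n : ℕ) (μ : Fin n → Measure ℝ) (w : Fin n → ℝ),
        (∀ i, IsProbabilityMeasure (μ i)) →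
        (∀ i, μ i (Set.Iio 0) = 0) →
        (∀ i, SocialGoods.IsRegular (μ i)) →
        (∀ i, w i ∈ Set.Icc (0 : ℝ) 1) →
        ∃ (t : ℕ) (s : RealRAM.State),
          RealRAM.Exec (SocialGoods.quantileOracle μ) alg (SocialGoods.initialState w) t s ∧
          t ≤ P.eval n ∧
          (∀ i, 0 ≤ SocialGoods.outputPrices n s i) ∧
          ∀ T : Fin n → ℝ≥0∞,
            SocialGoods.IsEquilibrium μ (SocialGoods.statusExternality w)
              (fun i => ENNReal.ofReal (SocialGoods.outputPrices n s i)) T →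
            SocialGoods.optimalRevenue μ (SocialGoods.statusExternality w) ≤
              ENNReal.ofReal 6.83 *
                SocialGoods.revenue μ
                  (fun i => ENNReal.ofReal (SocialGoods.outputPrices n s i)) T := by
  refine ⟨SocialGoods.pricing, SocialGoods.pricingTimePolynomial, fun n μ w hμ h0 hreg hw => ?_⟩
  obtain ⟨t, s, hexec, ht, c, hc, hcase⟩ := SocialGoods.runs_pricing
    (O := SocialGoods.quantileOracle μ) (s := SocialGoods.initialState w) (n := n)
    (by simp [SocialGoods.initialState]) (by simp [SocialGoods.initialState])
    (by simp [SocialGoods.initialState])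
  refine ⟨t, s, hexec, ht.trans_eq (SocialGoods.eval_pricingTimePolynomial n).symm, ?_⟩
  have hopt := SocialGoods.optimalRevenue_le hμ h0 hreg hw hc
  have hc0 := hc.1
  have hs : (SocialGoods.scaleFactor : ℝ) = 2929 / 5000 := by norm_num [SocialGoods.scaleFactor]
  set A := SocialGoods.sweepTotal (SocialGoods.quantileOracle μ) (fun x => 1 - x)
    ((SocialGoods.initialState w).arr 0) n 0 with hA
  -- The guarantee `V` of the chosen branch dominates that of the other one, so both `A` and `c` are
  -- bounded by multiples of `V`. With `a = 2929 / 5000`, the resulting factor `10001 / 10000 * (1 +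
  -- (2 - a) / (a (1 - a)))` is below `6.83`.
  suffices h : (∀ i, 0 ≤ SocialGoods.outputPrices n s i) ∧ ∃ V : ℝ, A ≤ V ∧
      SocialGoods.scaleFactor * (1 - SocialGoods.scaleFactor) * c ≤ V ∧
      ∀ T, SocialGoods.IsEquilibrium μ (SocialGoods.statusExternality w)
        (fun i => ENNReal.ofReal (SocialGoods.outputPrices n s i)) T →
        ENNReal.ofReal V ≤ SocialGoods.revenue μ
          (fun i => ENNReal.ofReal (SocialGoods.outputPrices n s i)) T by
    obtain ⟨hnn, V, hAV, hcV, hV⟩ := h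
    refine ⟨hnn, fun T hT => hopt.trans (le_trans ?_ (mul_le_mul_right (hV T hT) _))⟩
    rw [← ENNReal.ofReal_mul (by norm_num)]
    refine ENNReal.ofReal_le_ofReal ?_
    rw [hs] at hcV ⊢
    norm_num at hcV ⊢
    linarith
  push_cast at hcase
  rcases hcase with ⟨hle, hout⟩ | ⟨hle, hout⟩
  · obtain ⟨h1, h2⟩ := SocialGoods.revenue_ge_of_scaled hμ h0 hreg hw hc
      (P := SocialGoods.outputPrices n s) fun i => by
        rw [SocialGoods.outputPrices, hout i i.isLt, SocialGoods.initialState_weight]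
    exact ⟨h1, _, hle, le_rfl, h2⟩
  · obtain ⟨h1, h2⟩ := SocialGoods.revenue_ge_of_discounted hμ h0 hreg hw
      (P := SocialGoods.outputPrices n s) fun i => by
        rw [SocialGoods.outputPrices, hout i i.isLt, SocialGoods.initialState_weight]
    exact ⟨h1, A, le_rfl, hle, h2⟩
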